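/- **Setting.** Let $d\in\{2,3\}$, let $K,B,C,c,B_0,q>0$ and $A,a,b\in\mathbb R$, with $A<0$ if $d=2$ and $A<\frac{B^2}{27C}$ if $d=3$, and put $s_+=\sqrt{-2A/C}$ if $d=2$, $s_+=\frac{B+\sqrt{B^2-24AC}}{4C}$ if $d=3$. On the periodic uniform mesh with $J\ge 1$ cells of size $h=L_d/J$ in each of the $d$ directions let $D_k^{+},D_k^-,D_k^c$ be the forward, backward and central differences, $\Delta_h=\sum_k D_k^+D_k^-$, $D_h^2u=(D_k^cD_l^cu)_{k,l}$, $\nabla_h\cdot$ the divergence formed with $D_k^-$, $\langle U,V\rangle_h=h^d\sum_x U(x)V(x)$ (sum over one period; summed over components for tensors), $|\cdot|_F$ the Frobenius norm and $\|\Phi\|_\infty=\max_x|\Phi(x)|_F$. For a symmetric traceless $d\times d$ tensor grid function $Q$, a scalar grid function $u$ and $s\in\mathbb R$ put $M=\frac{Q}{s_+}+\frac{I}{d}$ and $$E_{1h}(Q,u)=2B_0q^2\langle D_h^2u,Mu\rangle_h+B_0q^4\|Mu\|_h^2+\langle f_{bn}(Q),1\rangle_h+\langle f_s(u),1\rangle_h,\qquad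 g(Q,u,s)=\frac{e^{s}}{e^{E_{1h}(Q,u)}},$$ where $f_{bn}(Q)=\frac A2\operatorname{tr}Q^2+\frac C4(\operatorname{tr}Q^2)^2$ for $d=2$, with the additional term $-\frac B3\operatorname{tr}Q^3$ for $d=3$, and $f_s(u)=\frac a2u^2+\frac b3u^3+\frac c4u^4$. Put further $$\mathbf T(u)=\tfrac{2B_0q^2}{s_+}\Big(u\,D_h^2u-\tfrac{\operatorname{tr}(u D_h^2u)}{d}I\Big),\qquad \tilde A(u)=A+\tfrac{2B_0q^4}{s_+^2}u^2,$$ $$H(Q,u)=\tilde A(u)\,Q-B\Big(Q^2-\tfrac{\operatorname{tr}Q^2}{d}I\Big)+C\operatorname{tr}(Q^2)\,Q+\mathbf T(u),$$ $$\mu(Q,u)=au+bu^2+cu^3+2B_0q^2\,M:D_h^2u+2B_0q^2\,\nabla_h\cdot(\nabla_h\cdot(Mu))+2B_0q^4|M|_F^2u .$$ **Scheme.** Fix $\eta_0\in[0,1]$, a symmetric traceless $Q_h^0$, and $u_h^0$, and put $s^0=E_{1h}(Q_h^0,u_h^0)$. For a time step $\tau>0$ and stabilization constants $\kappa_1,\kappa_2>0$,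 a numerical solution is a sequence $(Q_h^n,u_h^n,s^n)_{n\ge0}$ such that, with $g^n=g(Q_h^n,u_h^n,s^n)$, $\mathcal L=-K\Delta_h+g^n\kappa_1$, $\mathcal D=2B_0\Delta_h^2+g^n\kappa_2$, $H^n=H(Q_h^n,u_h^n)$, $\mu^n=\mu(Q_h^n,u_h^n)$ and $\phi_1(z)=(e^z-1)/z$, $$Q_h^{n+1}=e^{-\tau\mathcal L}Q_h^n+\tau\phi_1(-\tau\mathcal L)\big(-g^nH^n+g^n\kappa_1Q_h^n\big),\qquad u_h^{n+1}=e^{-\tau\mathcal D}u_h^n+\tau\phi_1(-\tau\mathcal D)\big(-g^n\mu^n+g^n\kappa_2u_h^n\big),$$ $$\tilde s^{n+1}=s^n+g^n\big(\langle H^n,\delta Q^{n+1}\rangle_h+\langle\mu^n,\delta u^{n+1}\rangle_h\big),\qquad s^{n+1}=\xi\tilde s^{n+1}+(1-\xi)E_{1h}(Q_h^{n+1},u_h^{n+1}),$$ where $\delta Q^{n+1}=Q_h^{n+1}-Q_h^n$, $\delta u^{n+1}=u_h^{n+1}-u_h^n$ and $\xi=\xi^{n+1}\in[0,1]$ is any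 number with $s^{n+1}-\tilde s^{n+1}\le\eta_0\tau\mathcal R^{n+1}$; here $\mathcal R^{n+1}=\frac1\tau\big(\langle\mathcal Q_1(\tau\mathcal L)\delta Q^{n+1},\delta Q^{n+1}\rangle_h+\langle\mathcal Q_1(\tau\mathcal D)\delta u^{n+1},\delta u^{n+1}\rangle_h\big)$ and $\mathcal Q_1(z)=\frac z{e^z-1}+\frac z2$. **Constants.** We say that $G_*>0$, $S$ and $\bar A$ are bounds at level $n$ if $g^n\ge G_*$, $\|\mathbf T(u_h^n)\|_\infty\le S$ and $\sup_x\tilde A(u_h^n)(x)\le\bar A$. With $b_2=0$, $b_3=|B|/\sqrt6$ put $f_d(\xi)=-A\xi+b_d\xi^2-C\xi^3+S$ and $$\kappa_0=\max\Big\{\bar A+C\eta^2,\ \max_{\xi\in[0,\eta]}\big(A-2b_d\xi+3C\xi^2\big)\Big\}.$$ **Theorem (maximum bound principle).** 1. For every $T>0$ there are $G_*>0$, $S$, $\bar A$, independent of $\tau$, $\kappa_1$, $\kappa_2$ and $n$, which are bounds at every level $n$ with $n\tau\le T$, for every numerical solution with these initial data. 2. For every $S$, all sufficiently large $\eta$ satisfy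 $f_d(\eta)\le0$. 3. Let $\tau,\kappa_1,\kappa_2>0$ be arbitrary, let $(Q_h^n,u_h^n,s^n)$ be a numerical solution, let $N\in\{0,1,2,\dots\}\cup\{\infty\}$, and let $G_*>0,S,\bar A$ be bounds at all levels $n<N$. If $\eta>0$ satisfies $f_d(\eta)\le0$, $\|Q_h^0\|_\infty\le\eta$ and $\kappa_1\ge\kappa_0/G_*$, then $$\|Q_h^n\|_\infty\le\eta\qquad\text{for all }0\le n\le N,\ n<\infty.$$ -/

import Mathlib

namespace Smectic

noncomputable section

/-- Nodes of the uniform periodic mesh with `J` cells in each of the `d` directions. -/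
abbrev Grid (d J : ℕ) := Fin d → ZMod J

/-- Periodic scalar grid functions. -/
abbrev Scalar (d J : ℕ) := Grid d J → ℝ

/-- Periodic `d × d` tensor-valued grid functions. -/
abbrev Tensor (d J : ℕ) := Grid d J → Matrix (Fin d) (Fin d) ℝ

/-- Linear operators on scalar grid functions. -/
abbrev Op (d J : ℕ) := Scalar d J →L[ℝ] Scalar d J

/-- Symmetric traceless tensor grid functions. -/
def IsQTensor {d J : ℕ} (Q : Tensor d J) : Prop :=
  ∀ x, (Q x).IsSymm ∧ (Q x).trace = 0

/-! ### Finite differences -/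

section Differences

variable {d J : ℕ} [NeZero J]

/-- `(shift k r U) x = U (x + r e_k)`. -/
def shift (k : Fin d) (r : ZMod J) : Scalar d J →ₗ[ℝ] Scalar d J :=
  LinearMap.funLeft ℝ ℝ (fun x : Grid d J => x + Pi.single k r)

/-- Forward difference. -/
def dPlus (h : ℝ) (k : Fin d) : Scalar d J →ₗ[ℝ] Scalar d J :=
  h⁻¹ • (shift k 1 - LinearMap.id)

/-- Backward difference. -/
def dMinus (h : ℝ) (k : Fin d) : Scalar d J →ₗ[ℝ] Scalar d J :=
  h⁻¹ • (LinearMap.id - shift k (-1))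

/-- Central difference. -/
def dCentral (h : ℝ) (k : Fin d) : Scalar d J →ₗ[ℝ] Scalar d J :=
  (2 * h)⁻¹ • (shift k 1 - shift k (-1))

/-- Discrete Laplacian `∑ₖ Dₖ⁺ Dₖ⁻`. -/
def laplacian (h : ℝ) : Op d J :=
  LinearMap.toContinuousLinearMap (∑ k : Fin d, dPlus h k ∘ₗ dMinus h k)

/-- Discrete Hessian, with entries `Dₖᶜ Dₗᶜ u`. -/
def hessian (h : ℝ) (u : Scalar d J) : Tensor d J :=
  fun x => Matrix.of fun k l => dCentral h k (dCentral h l u) x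

/-- `∇_h · (∇_h · Φ)`, with the backward-difference divergence. -/
def divDiv (h : ℝ) (Φ : Tensor d J) : Scalar d J :=
  ∑ k : Fin d, dMinus h k (∑ l : Fin d, dMinus h l (fun x => Φ x k l))

/-- Discrete inner product of scalar grid functions (sum over one full period). -/
def inner (h : ℝ) (U V : Scalar d J) : ℝ := h ^ d * ∑ x, U x * V x

/-- Discrete Frobenius inner product of tensor grid functions. -/
def innerT (h : ℝ) (Φ Ψ : Tensor d J) : ℝ :=
  ∑ i, ∑ j, inner h (fun x => Φ x i j) (fun x => Ψ x i j)

/-- An operator on scalar grid functions acting on every component of a tensor. -/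
def Op.onTensor (L : Op d J) (Φ : Tensor d J) : Tensor d J :=
  fun x => Matrix.of fun i j => L (fun y => Φ y i j) x

end Differences

/-- Frobenius norm of a matrix. -/
def frob {d : ℕ} (M : Matrix (Fin d) (Fin d) ℝ) : ℝ := √(∑ i, ∑ j, M i j ^ 2)

/-- `‖Φ‖_∞`, the maximum over the mesh of the pointwise Frobenius norm. -/
def supNorm {d J : ℕ} [NeZero J] (Φ : Tensor d J) : ℝ :=
  Finset.univ.sup' Finset.univ_nonempty fun x => frob (Φ x)

/-! ### Operator functions -/

section OperatorFunctions

variable {d J : ℕ} [NeZero J]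

/-- `φ₁(z) = (e^z - 1) / z` at an invertible operator. -/
def phi1 (Z : Op d J) : Op d J := Ring.inverse Z * (NormedSpace.exp Z - 1)

/-- `𝒬(z) = z / (e^z - 1)` at an operator `Z` for which `e^Z - 1` is invertible. -/
def calQ (Z : Op d J) : Op d J := Z * Ring.inverse (NormedSpace.exp Z - 1)

/-- `𝒬₁(z) = z / (e^z - 1) + z / 2`. -/
def calQ1 (Z : Op d J) : Op d J := calQ Z + (1 / 2 : ℝ) • Z

end OperatorFunctions

/-! ### The model -/

/-- Physical parameters: elastic constant `K`, nematic bulk constants `A, B, C`, smectic bulk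
constants `a, b, c`, coupling strength `B0`, wave number `q`. -/
structure Params where
  (K A B C a b c B0 q : ℝ)

namespace Params

/-- Sign conditions, in the regime in which `Q` and `u` are coupled and `s₊` is defined. -/
structure Admissible (p : Params) (d : ℕ) : Prop where
  K_pos : 0 < p.K
  B_pos : 0 < p.B
  C_pos : 0 < p.C
  c_pos : 0 < p.c
  B0_pos : 0 < p.B0
  q_pos : 0 < p.q
  regime : (d = 2 ∧ p.A < 0) ∨ (d = 3 ∧ p.A < p.B ^ 2 / (27 * p.C))

/-- The reference order parameter `s₊` (`d = 2` or `d = 3`). -/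
def sPlus (p : Params) (d : ℕ) : ℝ :=
  if d = 2 then √(-2 * p.A / p.C)
  else (p.B + √(p.B ^ 2 - 24 * p.A * p.C)) / (4 * p.C)

/-- Nematic bulk energy density. -/
def fbn (p : Params) {d : ℕ} (M : Matrix (Fin d) (Fin d) ℝ) : ℝ :=
  if d = 2 then p.A / 2 * (M ^ 2).trace + p.C / 4 * (M ^ 2).trace ^ 2
  else p.A / 2 * (M ^ 2).trace - p.B / 3 * (M ^ 3).trace + p.C / 4 * (M ^ 2).trace ^ 2

/-- Smectic bulk energy density. -/
def fs (p : Params) (v : ℝ) : ℝ := p.a / 2 * v ^ 2 + p.b / 3 * v ^ 3 + p.c / 4 * v ^ 4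

variable {d J : ℕ} [NeZero J]

/-- `M = Q / s₊ + I / d`. -/
def orient (p : Params) (Q : Tensor d J) : Tensor d J :=
  fun x => (p.sPlus d)⁻¹ • Q x + (d : ℝ)⁻¹ • (1 : Matrix (Fin d) (Fin d) ℝ)

/-- The discrete nonlinear energy `E_{1h}`. -/
def energy1 (p : Params) (h : ℝ) (Q : Tensor d J) (u : Scalar d J) : ℝ :=
  2 * p.B0 * p.q ^ 2 * innerT h (hessian h u) (fun x => u x • p.orient Q x)
    + p.B0 * p.q ^ 4 * innerT h (fun x => u x • p.orient Q x) (fun x => u x • p.orient Q x)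
    + inner h (fun x => p.fbn (Q x)) 1 + inner h (fun x => p.fs (u x)) 1

/-- The factor `g = exp(s) / exp(E_{1h}(Q, u))`. -/
def gFactor (p : Params) (h : ℝ) (Q : Tensor d J) (u : Scalar d J) (s : ℝ) : ℝ :=
  Real.exp s / Real.exp (p.energy1 h Q u)

/-- The forcing term `(2 B₀ q² / s₊) (u D²u - tr(u D²u)/d I)`. -/
def forcing (p : Params) (h : ℝ) (u : Scalar d J) : Tensor d J :=
  fun x => (2 * p.B0 * p.q ^ 2 / p.sPlus d) •
    (u x • hessian h u x
      - ((u x • hessian h u x).trace / (d : ℝ)) • (1 : Matrix (Fin d) (Fin d) ℝ))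

/-- The nonlinear variation with respect to `Q`. -/
def varQ (p : Params) (h : ℝ) (Q : Tensor d J) (u : Scalar d J) : Tensor d J :=
  fun x => p.A • Q x
    - p.B • (Q x ^ 2 - ((Q x ^ 2).trace / (d : ℝ)) • (1 : Matrix (Fin d) (Fin d) ℝ))
    + (p.C * (Q x ^ 2).trace) • Q x
    + p.forcing h u x
    + (2 * p.B0 * p.q ^ 4 / p.sPlus d ^ 2 * u x ^ 2) • Q x

/-- The nonlinear variation with respect to `u`. -/
def varU (p : Params) (h : ℝ) (Q : Tensor d J) (u : Scalar d J) : Scalar d J :=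
  fun x => p.a * u x + p.b * u x ^ 2 + p.c * u x ^ 3
    + 2 * p.B0 * p.q ^ 2 * ∑ i, ∑ j, p.orient Q x i j * hessian h u x i j
    + 2 * p.B0 * p.q ^ 2 * divDiv h (fun y => u y • p.orient Q y) x
    + 2 * p.B0 * p.q ^ 4 * (∑ i, ∑ j, p.orient Q x i j ^ 2) * u x

/-- `ℒ_h = -K Δ_h + g κ₁`. -/
def opQ (p : Params) (h g κ₁ : ℝ) : Op d J := -(p.K • laplacian h) + (g * κ₁) • (1 : Op d J)

/-- `𝒟_h = 2 B₀ Δ_h² + g κ₂`. -/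
def opU (p : Params) (h g κ₂ : ℝ) : Op d J :=
  (2 * p.B0) • (laplacian h * laplacian h) + (g * κ₂) • (1 : Op d J)

/-- One step of the exponential integrator for `Q`:
`e^{-τℒ} Q + τ φ₁(-τℒ) N` with `N = -g H + g κ₁ Q`. -/
def stepQ (p : Params) (h τ κ₁ : ℝ) (Q : Tensor d J) (u : Scalar d J) (s : ℝ) : Tensor d J :=
  let g := p.gFactor h Q u s
  let L : Op d J := p.opQ h g κ₁
  Op.onTensor (NormedSpace.exp (-(τ • L))) Q
    + τ • Op.onTensor (phi1 (-(τ • L))) (-(g • p.varQ h Q u) + (g * κ₁) • Q)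

/-- One step of the exponential integrator for `u`. -/
def stepU (p : Params) (h τ κ₂ : ℝ) (Q : Tensor d J) (u : Scalar d J) (s : ℝ) : Scalar d J :=
  let g := p.gFactor h Q u s
  let L : Op d J := p.opU h g κ₂
  NormedSpace.exp (-(τ • L)) u
    + τ • phi1 (-(τ • L)) (-(g • p.varU h Q u) + (g * κ₂) • u)

/-- The provisional auxiliary variable `s̃` at the new level `(Q', u')`. -/
def provisionalS (p : Params) (h : ℝ) (Q : Tensor d J) (u : Scalar d J) (s : ℝ)
    (Q' : Tensor d J) (u' : Scalar d J) : ℝ :=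
  s + p.gFactor h Q u s *
    (innerT h (p.varQ h Q u) (Q' - Q) + inner h (p.varU h Q u) (u' - u))

/-- The discrete dissipation rate
`ℛ = (1/τ) (⟨𝒬₁(τℒ) δQ, δQ⟩ + ⟨𝒬₁(τ𝒟) δu, δu⟩)`. -/
def dissipation (p : Params) (h τ κ₁ κ₂ : ℝ) (Q : Tensor d J) (u : Scalar d J) (s : ℝ)
    (Q' : Tensor d J) (u' : Scalar d J) : ℝ :=
  let g := p.gFactor h Q u s
  1 / τ * (innerT h (Op.onTensor (calQ1 (τ • p.opQ h g κ₁)) (Q' - Q)) (Q' - Q)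
    + inner h (calQ1 (τ • p.opU h g κ₂) (u' - u)) (u' - u))

/-- `(Qⁿ, uⁿ, sⁿ)` is generated by the relaxed exponential-integrator scheme from `(Q₀, u₀)`,
with `s⁰ = E_{1h}(Q₀, u₀)` and any admissible choice of the relaxation parameters `ξ`. -/
structure IsNumericalSolution (p : Params) (h η₀ τ κ₁ κ₂ : ℝ) (Q₀ : Tensor d J) (u₀ : Scalar d J)
    (Q : ℕ → Tensor d J) (u : ℕ → Scalar d J) (s : ℕ → ℝ) : Prop where
  init_Q : Q 0 = Q₀
  init_u : u 0 = u₀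
  init_s : s 0 = p.energy1 h Q₀ u₀
  step_Q : ∀ n, Q (n + 1) = p.stepQ h τ κ₁ (Q n) (u n) (s n)
  step_u : ∀ n, u (n + 1) = p.stepU h τ κ₂ (Q n) (u n) (s n)
  step_s : ∀ n, ∃ ξ ∈ Set.Icc (0 : ℝ) 1,
    s (n + 1) = ξ * p.provisionalS h (Q n) (u n) (s n) (Q (n + 1)) (u (n + 1))
      + (1 - ξ) * p.energy1 h (Q (n + 1)) (u (n + 1)) ∧
    s (n + 1) - p.provisionalS h (Q n) (u n) (s n) (Q (n + 1)) (u (n + 1))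
      ≤ η₀ * τ * p.dissipation h τ κ₁ κ₂ (Q n) (u n) (s n) (Q (n + 1)) (u (n + 1))

/-! ### The constants of the maximum bound principle -/

/-- `Ã(x) = A + (2 B₀ q⁴ / s₊²) u(x)²`. -/
def aTilde (p : Params) (u : Scalar d J) (x : Grid d J) : ℝ :=
  p.A + 2 * p.B0 * p.q ^ 4 / p.sPlus d ^ 2 * u x ^ 2

/-- `G` is a lower bound of `g`, `S` an upper bound of `‖forcing‖_∞` and `Amax` an upper bound
of `Ã`, at the state `(Q, u, s)`. -/
structure LevelBounds (p : Params) (h G S Amax : ℝ) (Q : Tensor d J) (u : Scalar d J) (s : ℝ) :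
    Prop where
  le_g : G ≤ p.gFactor h Q u s
  forcing_le : supNorm (p.forcing h u) ≤ S
  aTilde_le : ∀ x, p.aTilde u x ≤ Amax

/-- `b₂ = 0`, `b₃ = |B| / √6`. -/
def bCoeff (p : Params) (d : ℕ) : ℝ := if d = 2 then 0 else |p.B| / √6

/-- `f_d(ξ) = -A ξ + b_d ξ² - C ξ³ + S`. -/
def fPoly (p : Params) (d : ℕ) (S ξ : ℝ) : ℝ :=
  -p.A * ξ + p.bCoeff d * ξ ^ 2 - p.C * ξ ^ 3 + S

/-- `κ₀ = max { Amax + C η², max_{ξ ∈ [0, η]} (A - 2 b_d ξ + 3 C ξ²) }`. -/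
def kappa0 (p : Params) (d : ℕ) (Amax η : ℝ) : ℝ :=
  max (Amax + p.C * η ^ 2)
    (sSup ((fun ξ : ℝ => p.A - 2 * p.bCoeff d * ξ + 3 * p.C * ξ ^ 2) '' Set.Icc 0 η))

end Params

end

end Smectic

/-!
The operator `-K Δ_h` has nonpositive off-diagonal entries and annihilates constants, so
`e^{τ K Δ_h}` is an averaging operator and `τ φ₁(-τℒ) = ∫₀^τ e^{-σℒ} dσ`. Hence one exponential step
keeps `‖Q‖_∞ ≤ η` as soon as the pointwise right-hand side satisfies `|κ₁ Q - H|_F ≤ κ₁ η` whenever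
`|Q|_F ≤ η`. Writing `ξ = |Q|_F`, the choice of `κ₀` makes `κ₁ ξ + f_d(ξ)` increasing on `[0, η]`,
and `f_d(η) ≤ 0` bounds its value at `η`; the traceless part of `Q²` vanishes for `d = 2` and has
Frobenius norm `|Q|_F² / √6` for `d = 3`.

For the uniform bounds, every step satisfies an energy law for a modified energy in which `s` stands
in for `E_{1h}`. If `η₀ τ ≤ 1`, the modified energy does not increase and bounds `s` from above. The
quartic bulk terms make `E_{1h}` coercive, so `g |H|` and `g |μ|` are bounded by a multiple of `e^s`
in spite of the cubic growth of `H` and `μ`; increments are then `O(τ)` and a discrete Gronwall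
argument bounds the solution on `[0, T]`. If `η₀ τ > 1`, at most `η₀ T` steps fit in `[0, T]`, and
each level is bounded in terms of the previous one.
-/

open scoped Matrix

namespace Smectic

noncomputable section

/-! ### The discrete Laplacian -/

section Laplacian

variable {d J : ℕ}

theorem shift_apply (k : Fin d) (r : ZMod J) (U : Scalar d J) (x : Grid d J) :
    shift k r U x = U (x + Pi.single k r) := rfl

variable [NeZero J]

theorem shift_dotProduct (k : Fin d) (r : ZMod J) (U V : Scalar d J) :
    shift k r U ⬝ᵥ V = U ⬝ᵥ shift k (-r) V := by
  unfold dotProduct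
  rw [← Equiv.sum_comp (Equiv.addRight (Pi.single k r : Grid d J))
    (fun x => U x * shift k (-r) V x)]
  refine Finset.sum_congr rfl fun x _ => ?_
  simp [shift_apply, add_assoc, ← Pi.single_add]

theorem dPlus_dotProduct (h : ℝ) (k : Fin d) (U V : Scalar d J) :
    dPlus h k U ⬝ᵥ V = -(U ⬝ᵥ dMinus h k V) := by
  simp only [dPlus, dMinus, LinearMap.smul_apply, LinearMap.sub_apply, LinearMap.id_apply,
    smul_dotProduct, dotProduct_smul, sub_dotProduct, dotProduct_sub, shift_dotProduct, smul_eq_mul]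
  ring

theorem laplacian_apply (h : ℝ) (U : Scalar d J) :
    laplacian h U = ∑ k : Fin d, dPlus h k (dMinus h k U) := by
  simp [laplacian]

theorem laplacian_apply_apply (h : ℝ) (U : Scalar d J) (x : Grid d J) :
    laplacian h U x = ∑ k : Fin d,
      h⁻¹ * h⁻¹ * (U (x + Pi.single k 1) + U (x + Pi.single k (-1)) - 2 * U x) := by
  rw [laplacian_apply, Finset.sum_apply]
  refine Finset.sum_congr rfl fun k _ => ?_
  simp only [dPlus, dMinus, LinearMap.smul_apply, LinearMap.sub_apply, LinearMap.id_apply,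
    Pi.smul_apply, Pi.sub_apply, shift_apply, smul_eq_mul, add_assoc, ← Pi.single_add,
    add_neg_cancel, Pi.single_zero, add_zero]
  ring

theorem laplacian_const (h m : ℝ) : laplacian h (Function.const (Grid d J) m) = 0 := by
  ext x
  rw [laplacian_apply_apply]
  exact Finset.sum_eq_zero fun k _ => by simp only [Function.const_apply]; ring

theorem laplacian_dotProduct (h : ℝ) (U V : Scalar d J) :
    laplacian h U ⬝ᵥ V = -∑ k : Fin d, dMinus h k U ⬝ᵥ dMinus h k V := by
  rw [laplacian_apply, sum_dotProduct, ← Finset.sum_neg_distrib]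
  exact Finset.sum_congr rfl fun k _ => dPlus_dotProduct h k _ _

end Laplacian

/-! ### Symmetric and positive operators -/

namespace Op

variable {d J : ℕ}

section Forms

variable [NeZero J]

/-- Self-adjointness for the unweighted `ℓ²` pairing of grid functions. -/
def IsSymm (Z : Op d J) : Prop := ∀ U V, Z U ⬝ᵥ V = U ⬝ᵥ Z V

/-- Symmetric positive semidefinite operators for the unweighted `ℓ²` pairing. -/
structure IsPosSemidef (Z : Op d J) : Prop where
  isSymm : IsSymm Z
  nonneg : ∀ U, 0 ≤ Z U ⬝ᵥ U

/-- Symmetric positive definite operators for the unweighted `ℓ²` pairing. -/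
structure IsPosDef (Z : Op d J) : Prop where
  isSymm : IsSymm Z
  pos : ∀ U, U ≠ 0 → 0 < Z U ⬝ᵥ U

variable {Y Z : Op d J}

theorem IsSymm.smul (hZ : IsSymm Z) (r : ℝ) : IsSymm (r • Z) := fun U V => by
  rw [smul_apply, smul_apply, smul_dotProduct, dotProduct_smul, hZ]

theorem IsSymm.neg (hZ : IsSymm Z) : IsSymm (-Z) := fun U V => by
  rw [neg_apply, neg_apply, neg_dotProduct, dotProduct_neg, hZ]

theorem IsSymm.pow (hZ : IsSymm Z) (n : ℕ) : IsSymm (Z ^ n) := by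
  induction n with
  | zero => exact fun _ _ => rfl
  | succ n ih =>
    intro U V
    rw [pow_succ, mul_apply_eq_comp, ih, hZ, ← mul_apply_eq_comp, ← pow_succ', pow_succ]

theorem IsSymm.isPosSemidef_mul_self (hZ : IsSymm Z) : IsPosSemidef (Z * Z) where
  isSymm := by simpa only [sq] using hZ.pow 2
  nonneg U := by
    rw [mul_apply_eq_comp, hZ]
    exact Finset.sum_nonneg fun x _ => mul_self_nonneg _

theorem IsPosSemidef.smul (hZ : IsPosSemidef Z) {r : ℝ} (hr : 0 ≤ r) : IsPosSemidef (r • Z) where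
  isSymm := hZ.isSymm.smul r
  nonneg U := by
    rw [smul_apply, smul_dotProduct]
    exact mul_nonneg hr (hZ.nonneg U)

theorem IsPosDef.isPosSemidef (hZ : IsPosDef Z) : IsPosSemidef Z where
  isSymm := hZ.isSymm
  nonneg U := by
    rcases eq_or_ne U 0 with rfl | hU
    · simp
    · exact (hZ.pos U hU).le

theorem IsPosDef.smul (hZ : IsPosDef Z) {r : ℝ} (hr : 0 < r) : IsPosDef (r • Z) where
  isSymm := hZ.isSymm.smul r
  pos U hU := by
    rw [smul_apply, smul_dotProduct]
    exact mul_pos hr (hZ.pos U hU)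

theorem dotProduct_self_pos {U : Scalar d J} (hU : U ≠ 0) : 0 < U ⬝ᵥ U :=
  (Finset.sum_nonneg fun x _ => mul_self_nonneg (U x)).lt_of_ne'
    (dotProduct_self_eq_zero.not.mpr hU)

theorem IsPosSemidef.add_smul_one (hZ : IsPosSemidef Z) {γ : ℝ} (hγ : 0 < γ) :
    IsPosDef (Z + γ • (1 : Op d J)) where
  isSymm U V := by
    simp only [add_apply, smul_apply, one_apply_eq_self, add_dotProduct, dotProduct_add,
      smul_dotProduct, dotProduct_smul, hZ.isSymm U V]
  pos U hU := by
    simp only [add_apply, smul_apply, one_apply_eq_self, add_dotProduct, smul_dotProduct]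
    exact add_pos_of_nonneg_of_pos (hZ.nonneg U) (smul_pos hγ (dotProduct_self_pos hU))

theorem IsPosDef.isUnit (hZ : IsPosDef Z) : IsUnit Z := by
  rw [ContinuousLinearMap.isUnit_iff_isUnit_toLinearMap, LinearMap.isUnit_iff_ker_eq_bot,
    LinearMap.ker_eq_bot']
  intro U hU
  by_contra hne
  have hZU : Z U = 0 := hU
  simpa [hZU] using hZ.pos U hne

theorem isSymm_laplacian (h : ℝ) : IsSymm (laplacian h : Op d J) := fun U V => by
  rw [dotProduct_comm U, laplacian_dotProduct, laplacian_dotProduct]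
  simp only [dotProduct_comm]

theorem isPosSemidef_neg_laplacian (h : ℝ) : IsPosSemidef (-laplacian h : Op d J) where
  isSymm := (isSymm_laplacian h).neg
  nonneg U := by
    rw [neg_apply, neg_dotProduct, laplacian_dotProduct, neg_neg]
    exact Finset.sum_nonneg fun k _ => Finset.sum_nonneg fun x _ => mul_self_nonneg _

end Forms

end Op

/-! ### Exponentials and `φ₁` of operators -/

section BanachAlgebra

variable {A : Type*} [NormedRing A] [NormedAlgebra ℝ A] [CompleteSpace A]

theorem continuous_exp_smul (a : A) : Continuous fun σ : ℝ => NormedSpace.exp (σ • a) := by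
  let _ := NormedAlgebra.restrictScalars ℚ ℝ A
  exact NormedSpace.exp_continuous.comp (continuous_id.smul continuous_const)

theorem integral_mul_exp_smul (a : A) :
    ∫ σ in (0 : ℝ)..1, a * NormedSpace.exp (σ • a) = NormedSpace.exp a - 1 := by
  rw [intervalIntegral.integral_eq_sub_of_hasDerivAt
    (f := fun σ : ℝ => NormedSpace.exp (σ • a)) (fun σ _ => hasDerivAt_exp_smul_const' a σ)
    ((continuous_const.mul (continuous_exp_smul a)).intervalIntegrable _ _)]
  simp

theorem exp_add_smul_one (a : A) (m : ℝ) :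
    NormedSpace.exp (a + m • (1 : A)) = Real.exp m • NormedSpace.exp a := by
  let _ := NormedAlgebra.restrictScalars ℚ ℝ A
  have hm : NormedSpace.exp (m • (1 : A)) = Real.exp m • (1 : A) := by
    simpa [Algebra.algebraMap_eq_smul_one, Real.exp_eq_exp_ℝ] using
      (NormedSpace.algebraMap_exp_comm (𝔸 := A) m).symm
  rw [NormedSpace.exp_add_of_commute ((Commute.one_right a).smul_right m), hm, mul_smul_comm,
    mul_one]

theorem exp_half_mul_exp_half (a : A) :
    NormedSpace.exp ((1 / 2 : ℝ) • a) * NormedSpace.exp ((1 / 2 : ℝ) • a) = NormedSpace.exp a := by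
  let _ := NormedAlgebra.restrictScalars ℚ ℝ A
  rw [← NormedSpace.exp_add_of_commute (Commute.refl _), ← add_smul, add_halves, one_smul]

end BanachAlgebra

namespace Op

variable {d J : ℕ} [NeZero J] {Z : Op d J} {U V : Scalar d J}

/-- The matrix coefficient `Z ↦ Z U ⬝ᵥ V`; exponential series and integrals of operators are
evaluated through it. -/
def coeff (U V : Scalar d J) : Op d J →L[ℝ] ℝ :=
  LinearMap.toContinuousLinearMap (dotProductBilin ℝ ℝ V) ∘L ContinuousLinearMap.apply ℝ _ U

theorem coeff_apply (U V : Scalar d J) (Z : Op d J) : coeff U V Z = Z U ⬝ᵥ V :=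
  dotProduct_comm _ _

theorem hasSum_exp_apply_dotProduct (Z : Op d J) (U V : Scalar d J) :
    HasSum (fun n : ℕ => (n.factorial : ℝ)⁻¹ * ((Z ^ n) U ⬝ᵥ V))
      (NormedSpace.exp Z U ⬝ᵥ V) := by
  simpa only [coeff_apply, smul_apply, smul_dotProduct, smul_eq_mul] using
    (coeff U V).hasSum (NormedSpace.exp_series_hasSum_exp' (𝕂 := ℝ) Z)

theorem continuous_exp_smul_apply_dotProduct (Z : Op d J) (U V : Scalar d J) :
    Continuous fun σ : ℝ => NormedSpace.exp (σ • Z) U ⬝ᵥ V := by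
  simpa only [Function.comp_def, coeff_apply] using
    (coeff U V).continuous.comp (continuous_exp_smul Z)

theorem mul_phi1 (hZ : IsUnit Z) : Z * phi1 Z = NormedSpace.exp Z - 1 := by
  rw [phi1, Ring.mul_inverse_cancel_left _ _ hZ]

theorem phi1_eq_integral (hZ : IsUnit Z) :
    phi1 Z = ∫ σ in (0 : ℝ)..1, NormedSpace.exp (σ • Z) := by
  have hcomm : ∫ σ in (0 : ℝ)..1, Z * NormedSpace.exp (σ • Z) =
      Z * ∫ σ in (0 : ℝ)..1, NormedSpace.exp (σ • Z) :=
    (ContinuousLinearMap.mul ℝ (Op d J) Z).intervalIntegral_comp_comm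
      ((continuous_exp_smul Z).intervalIntegrable _ _)
  rw [phi1, ← integral_mul_exp_smul, hcomm, Ring.inverse_mul_cancel_left _ _ hZ]

theorem phi1_apply_dotProduct (hZ : IsUnit Z) (U V : Scalar d J) :
    phi1 Z U ⬝ᵥ V = ∫ σ in (0 : ℝ)..1, NormedSpace.exp (σ • Z) U ⬝ᵥ V := by
  simpa only [coeff_apply, ← phi1_eq_integral hZ] using
    ((coeff U V).intervalIntegral_comp_comm
      ((continuous_exp_smul Z).intervalIntegrable (μ := MeasureTheory.volume) 0 1)).symm

theorem exp_apply_ne_zero (Z : Op d J) (hU : U ≠ 0) : NormedSpace.exp Z U ≠ 0 := by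
  let _ := NormedAlgebra.restrictScalars ℚ ℝ (Op d J)
  have hinj := (ContinuousLinearMap.isUnit_iff_bijective.mp (NormedSpace.isUnit_exp Z)).injective
  simpa using hinj.ne hU

theorem IsSymm.exp (hZ : IsSymm Z) : IsSymm (NormedSpace.exp Z) := fun U V => by
  have hsum := hasSum_exp_apply_dotProduct Z V U
  simp only [dotProduct_comm _ U, ← (hZ.pow _) U V] at hsum
  exact (hasSum_exp_apply_dotProduct Z U V).unique hsum

theorem IsSymm.exp_apply_dotProduct_self (hZ : IsSymm Z) (U : Scalar d J) :
    NormedSpace.exp Z U ⬝ᵥ U =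
      NormedSpace.exp ((1 / 2 : ℝ) • Z) U ⬝ᵥ NormedSpace.exp ((1 / 2 : ℝ) • Z) U := by
  rw [← exp_half_mul_exp_half, mul_apply_eq_comp, (hZ.smul _).exp]

theorem IsSymm.isPosDef_exp (hZ : IsSymm Z) : IsPosDef (NormedSpace.exp Z) where
  isSymm := hZ.exp
  pos U hU := by
    rw [hZ.exp_apply_dotProduct_self]
    exact dotProduct_self_pos (exp_apply_ne_zero _ hU)

theorem IsSymm.isPosDef_phi1 (hZ : IsSymm Z) (hu : IsUnit Z) : IsPosDef (phi1 Z) where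
  isSymm U V := by
    rw [dotProduct_comm U, phi1_apply_dotProduct hu, phi1_apply_dotProduct hu]
    simp only [(hZ.smul _).exp _ _, dotProduct_comm U]
  pos U hU := by
    rw [phi1_apply_dotProduct hu]
    exact intervalIntegral.intervalIntegral_pos_of_pos
      ((continuous_exp_smul_apply_dotProduct Z U U).intervalIntegrable _ _)
      (fun σ => (hZ.smul σ).isPosDef_exp.pos U hU) zero_lt_one

end Op

/-! ### The exponential step -/

section EtdStep

variable {d J : ℕ} [NeZero J]

/-- One step `e^{-τL} U + τ φ₁(-τL) N` of first-order exponential time differencing for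
`∂ₜU = -L U + N`. -/
def etdStep (L : Op d J) (τ : ℝ) (U N : Scalar d J) : Scalar d J :=
  NormedSpace.exp (-(τ • L)) U + τ • phi1 (-(τ • L)) N

namespace Op

variable {L Z : Op d J} {τ : ℝ} {U N : Scalar d J}

theorem phi1_mul (hZ : IsUnit Z) : phi1 Z * Z = NormedSpace.exp Z - 1 := by
  let _ := NormedAlgebra.restrictScalars ℚ ℝ (Op d J)
  have hcomm : Commute (NormedSpace.exp Z - 1) Z :=
    (Commute.refl Z).exp_left.sub_left (Commute.one_left Z)
  rw [phi1, mul_assoc, hcomm.eq, Ring.inverse_mul_cancel_left _ _ hZ]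

theorem etdStep_apply_self (hL : IsUnit L) (hτ : τ ≠ 0) (U : Scalar d J) :
    etdStep L τ U (L U) = U := by
  have hZ : IsUnit (-(τ • L)) := by
    rw [← Units.smul_mk0 hτ]
    exact (hL.smul _).neg
  have h : phi1 (-(τ • L)) (-(τ • L) U) = NormedSpace.exp (-(τ • L)) U - U := by
    rw [← neg_apply, ← mul_apply_eq_comp, phi1_mul hZ, sub_apply, one_apply_eq_self]
  rw [etdStep, ← map_smul, ← smul_apply, ← neg_neg ((τ • L) U), map_neg, h]
  abel

theorem etdStep_sub_self (hL : IsUnit L) (hτ : τ ≠ 0) (U N : Scalar d J) :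
    etdStep L τ U N - U = τ • phi1 (-(τ • L)) (N - L U) := by
  nth_rw 2 [← etdStep_apply_self hL hτ U]
  rw [etdStep, etdStep, map_sub, smul_sub]
  abel

end Op

end EtdStep

/-! ### Positivity and the maximum principle -/

namespace Op

variable {d J : ℕ} {L Z : Op d J} {τ : ℝ} {U N : Scalar d J}

/-- Metzler (quasi-positive) operators: those that become positivity preserving after adding a
multiple of the identity. They generate positivity preserving semigroups. -/
def IsMetzler (Z : Op d J) : Prop := ∃ m : ℝ, ∀ U, 0 ≤ U → 0 ≤ Z U + m • U

theorem IsMetzler.smul (hZ : IsMetzler Z) {r : ℝ} (hr : 0 ≤ r) : IsMetzler (r • Z) := by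
  obtain ⟨m, hm⟩ := hZ
  refine ⟨r * m, fun U hU => ?_⟩
  rw [smul_apply, mul_smul, ← smul_add]
  exact smul_nonneg hr (hm U hU)

theorem IsMetzler.sub_smul_one (hZ : IsMetzler Z) (γ : ℝ) : IsMetzler (Z - γ • (1 : Op d J)) := by
  obtain ⟨m, hm⟩ := hZ
  refine ⟨m + γ, fun U hU => ?_⟩
  convert hm U hU using 1
  simp only [sub_apply, smul_apply, one_apply_eq_self]
  module

variable [NeZero J]

theorem isMetzler_laplacian (h : ℝ) : IsMetzler (laplacian h : Op d J) := by
  refine ⟨∑ _k : Fin d, h⁻¹ * h⁻¹ * 2, fun U hU x => ?_⟩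
  have hsum : (laplacian h U + (∑ _k : Fin d, h⁻¹ * h⁻¹ * 2) • U) x =
      ∑ k : Fin d, h⁻¹ * h⁻¹ * (U (x + Pi.single k 1) + U (x + Pi.single k (-1))) := by
    rw [Pi.add_apply, Pi.smul_apply, smul_eq_mul, laplacian_apply_apply, Finset.sum_mul,
      ← Finset.sum_add_distrib]
    exact Finset.sum_congr rfl fun k _ => by ring
  rw [hsum]
  exact Finset.sum_nonneg fun k _ => mul_nonneg (mul_self_nonneg _) (add_nonneg (hU _) (hU _))

theorem exp_apply_nonneg (hZ : ∀ U, 0 ≤ U → 0 ≤ Z U) (hU : 0 ≤ U) : 0 ≤ NormedSpace.exp Z U := by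
  have hpow : ∀ n : ℕ, 0 ≤ (Z ^ n) U := by
    intro n
    induction n with
    | zero => simpa using hU
    | succ n ih =>
      rw [pow_succ', mul_apply_eq_comp]
      exact hZ _ ih
  intro x
  have hsum := hasSum_exp_apply_dotProduct Z U (Pi.single x 1)
  simp only [dotProduct_single_one] at hsum
  exact hsum.nonneg fun n => mul_nonneg (by positivity) (hpow n x)

theorem IsMetzler.exp_apply_nonneg (hZ : IsMetzler Z) (hU : 0 ≤ U) :
    0 ≤ NormedSpace.exp Z U := by
  obtain ⟨m, hm⟩ := hZ
  have hsplit : Z = (Z + m • (1 : Op d J)) + (-m) • (1 : Op d J) := by module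
  rw [hsplit, exp_add_smul_one]
  exact smul_nonneg (Real.exp_pos _).le (Op.exp_apply_nonneg (fun V hV => hm V hV) hU)

theorem IsMetzler.phi1_apply_nonneg (hZ : IsMetzler Z) (hu : IsUnit Z) (hU : 0 ≤ U) :
    0 ≤ phi1 Z U := by
  intro x
  have hint := phi1_apply_dotProduct hu U (Pi.single x 1)
  simp only [dotProduct_single_one] at hint
  rw [hint]
  exact intervalIntegral.integral_nonneg zero_le_one fun σ hσ =>
    (hZ.smul hσ.1).exp_apply_nonneg hU x

theorem etdStep_mono (hL : IsMetzler (-L)) (hu : IsUnit L) (hτ : 0 < τ) {U' N' : Scalar d J}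
    (hU : U ≤ U') (hN : N ≤ N') : etdStep L τ U N ≤ etdStep L τ U' N' := by
  have hZ : IsMetzler (-(τ • L)) := smul_neg τ L ▸ hL.smul hτ.le
  have hZu : IsUnit (-(τ • L)) := by
    rw [← Units.smul_mk0 hτ.ne']
    exact (hu.smul _).neg
  have hexp := hZ.exp_apply_nonneg (sub_nonneg.mpr hU)
  have hphi := hZ.phi1_apply_nonneg hZu (sub_nonneg.mpr hN)
  rw [map_sub, sub_nonneg] at hexp hphi
  exact add_le_add hexp (smul_le_smul_of_nonneg_left hphi hτ.le)

theorem etdStep_le (hL : IsMetzler (-L)) (hu : IsUnit L) (hτ : 0 < τ) {W : Scalar d J}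
    (hU : U ≤ W) (hN : N ≤ L W) : etdStep L τ U N ≤ W :=
  (etdStep_mono hL hu hτ hU hN).trans_eq (etdStep_apply_self hu hτ.ne' W)

end Op

/-! ### The `ℓ²` norm and the energy law -/

section L2

variable {d J : ℕ} [NeZero J]

/-- The unweighted `ℓ²` norm of a grid function. -/
def l2 (U : Scalar d J) : ℝ := ‖(WithLp.toLp 2 U : EuclideanSpace ℝ (Grid d J))‖

theorem l2_nonneg (U : Scalar d J) : 0 ≤ l2 U := norm_nonneg _

theorem l2_sq (U : Scalar d J) : l2 U ^ 2 = U ⬝ᵥ U := by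
  rw [l2, EuclideanSpace.norm_sq_eq]
  simp [dotProduct, sq]

theorem l2_add_le (U V : Scalar d J) : l2 (U + V) ≤ l2 U + l2 V := norm_add_le _ _

theorem l2_smul (r : ℝ) (U : Scalar d J) : l2 (r • U) = |r| * l2 U :=
  norm_smul r (WithLp.toLp 2 U : EuclideanSpace ℝ (Grid d J))

theorem abs_dotProduct_le (U V : Scalar d J) : |U ⬝ᵥ V| ≤ l2 U * l2 V := by
  refine abs_le_of_sq_le_sq ?_ (mul_nonneg (l2_nonneg _) (l2_nonneg _))
  rw [mul_pow, l2_sq, l2_sq]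
  simpa [dotProduct, sq] using Finset.sum_mul_sq_le_sq_mul_sq Finset.univ U V

theorem exists_l2_apply_le (T : Op d J) : ∃ l : ℝ, 0 ≤ l ∧ ∀ U, l2 (T U) ≤ l * l2 U := by
  let e := PiLp.continuousLinearEquiv 2 ℝ (fun _ : Grid d J => ℝ)
  let S : EuclideanSpace ℝ (Grid d J) →L[ℝ] EuclideanSpace ℝ (Grid d J) :=
    e.symm.toContinuousLinearMap ∘L T ∘L e.toContinuousLinearMap
  exact ⟨‖S‖, norm_nonneg _, fun U => S.le_opNorm (WithLp.toLp 2 U)⟩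

end L2

namespace Op

variable {d J : ℕ} [NeZero J] {Z : Op d J}

theorem IsPosSemidef.mul_exp_smul_apply_dotProduct_nonneg (hZ : IsPosSemidef Z) (r : ℝ)
    (U : Scalar d J) : 0 ≤ (Z * NormedSpace.exp (r • Z)) U ⬝ᵥ U := by
  let _ := NormedAlgebra.restrictScalars ℚ ℝ (Op d J)
  set E := NormedSpace.exp ((1 / 2 : ℝ) • r • Z) with hE
  have hcomm : Commute Z E := (((Commute.refl Z).smul_right r).smul_right _).exp_right
  have hconj : (Z * NormedSpace.exp (r • Z)) U ⬝ᵥ U = Z (E U) ⬝ᵥ E U := by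
    rw [← exp_half_mul_exp_half, ← hE, ← mul_assoc, hcomm.eq, mul_assoc, mul_apply_eq_comp,
      ((hZ.isSymm.smul r).smul _).exp, mul_apply_eq_comp]
  rw [hconj]
  exact hZ.nonneg _

theorem IsPosSemidef.exp_neg_apply_dotProduct_self_le (hZ : IsPosSemidef Z) (U : Scalar d J) :
    NormedSpace.exp (-Z) U ⬝ᵥ U ≤ U ⬝ᵥ U := by
  have hcont : Continuous fun σ : ℝ => -Z * NormedSpace.exp (σ • -Z) :=
    continuous_const.mul (continuous_exp_smul (-Z))
  have hint := ((coeff U U).intervalIntegral_comp_comm (hcont.intervalIntegrable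
    (μ := MeasureTheory.volume) 0 1)).trans (congrArg _ (integral_mul_exp_smul (-Z)))
  simp only [map_sub, coeff_apply, one_apply_eq_self] at hint
  rw [← sub_nonpos, ← hint, ← neg_nonneg, ← intervalIntegral.integral_neg]
  refine intervalIntegral.integral_nonneg zero_le_one fun σ _ => ?_
  have hσ : σ • -Z = -σ • Z := by module
  rw [mul_apply_eq_comp, neg_apply, neg_dotProduct, neg_neg, hσ, ← mul_apply_eq_comp]
  exact hZ.mul_exp_smul_apply_dotProduct_nonneg (-σ) U

theorem IsPosSemidef.l2_exp_neg_apply_le (hZ : IsPosSemidef Z) (U : Scalar d J) :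
    l2 (NormedSpace.exp (-Z) U) ≤ l2 U := by
  have h2Z : IsPosSemidef ((2 : ℝ) • Z) := hZ.smul zero_le_two
  have hle := h2Z.exp_neg_apply_dotProduct_self_le U
  have hhalf : (1 / 2 : ℝ) • -((2 : ℝ) • Z) = -Z := by module
  rw [h2Z.isSymm.neg.exp_apply_dotProduct_self, hhalf] at hle
  rw [← l2_sq, ← l2_sq] at hle
  exact abs_le_of_sq_le_sq' hle (l2_nonneg U) |>.2

theorem IsPosDef.l2_phi1_neg_apply_le (hZ : IsPosDef Z) (U : Scalar d J) :
    l2 (phi1 (-Z) U) ≤ l2 U := by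
  set V := phi1 (-Z) U with hV
  have hsq : l2 V ^ 2 ≤ l2 U * l2 V := by
    rw [l2_sq]
    nth_rw 1 [hV]
    rw [phi1_apply_dotProduct hZ.isUnit.neg]
    have hle : ∀ σ ∈ Set.Icc (0 : ℝ) 1, NormedSpace.exp (σ • -Z) U ⬝ᵥ V ≤ l2 U * l2 V := by
      intro σ hσ
      rw [smul_neg]
      exact (le_abs_self _).trans ((abs_dotProduct_le _ _).trans (mul_le_mul_of_nonneg_right
        ((hZ.isPosSemidef.smul hσ.1).l2_exp_neg_apply_le U) (l2_nonneg V)))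
    have hint := (continuous_exp_smul_apply_dotProduct (-Z) U V).intervalIntegrable
      (μ := MeasureTheory.volume) 0 1
    simpa using intervalIntegral.integral_mono_on zero_le_one hint intervalIntegrable_const hle
  rcases (l2_nonneg V).eq_or_lt with h0 | h0
  · rw [← h0]
    exact l2_nonneg U
  · exact le_of_mul_le_mul_right (by rwa [← sq]) h0

theorem mul_phi1_neg (hZ : IsUnit Z) : Z * phi1 (-Z) = 1 - NormedSpace.exp (-Z) := by
  rw [← neg_sub, ← mul_phi1 hZ.neg, neg_mul, neg_neg]

theorem phi1_neg (hZ : IsUnit Z) : phi1 (-Z) = phi1 Z * NormedSpace.exp (-Z) := by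
  let _ := NormedAlgebra.restrictScalars ℚ ℝ (Op d J)
  have hinv : NormedSpace.exp Z * NormedSpace.exp (-Z) = 1 := by
    rw [← NormedSpace.exp_add_of_commute (Commute.refl Z).neg_right, add_neg_cancel,
      NormedSpace.exp_zero]
  refine hZ.mul_left_cancel ?_
  rw [mul_phi1_neg hZ, ← mul_assoc, mul_phi1 hZ, sub_mul, hinv, one_mul]

theorem IsPosDef.calQ_mul_phi1 (hZ : IsPosDef Z) : calQ Z * phi1 Z = 1 := by
  have hunit : IsUnit (NormedSpace.exp Z - 1) := by
    rw [← mul_phi1 hZ.isUnit]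
    exact hZ.isUnit.mul (hZ.isSymm.isPosDef_phi1 hZ.isUnit).isUnit
  refine hZ.isUnit.mul_right_cancel ?_
  rw [mul_assoc, phi1_mul hZ.isUnit, calQ, mul_assoc, Ring.inverse_mul_cancel _ hunit, mul_one,
    one_mul]

theorem IsPosDef.calQ_apply_phi1_neg (hZ : IsPosDef Z) (W : Scalar d J) :
    calQ Z (phi1 (-Z) W) = W - Z (phi1 (-Z) W) := by
  rw [← mul_apply_eq_comp, phi1_neg hZ.isUnit, ← mul_assoc, hZ.calQ_mul_phi1, one_mul,
    ← phi1_neg hZ.isUnit, ← sub_sub_cancel 1 (NormedSpace.exp (-Z)), ← mul_phi1_neg hZ.isUnit,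
    sub_apply, one_apply_eq_self, mul_apply_eq_comp]

theorem IsPosDef.calQ1_dotProduct_nonneg (hZ : IsPosDef Z) (V : Scalar d J) :
    0 ≤ calQ1 Z V ⬝ᵥ V := by
  have hphi := hZ.isSymm.isPosDef_phi1 hZ.isUnit
  have hV : phi1 Z (calQ Z V) = V := by
    have hinv : phi1 Z * calQ Z = 1 := hphi.isUnit.mul_right_cancel (by
      rw [mul_assoc, hZ.calQ_mul_phi1, mul_one, one_mul])
    rw [← mul_apply_eq_comp, hinv, one_apply_eq_self]
  have hcalQ : 0 ≤ calQ Z V ⬝ᵥ V := by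
    nth_rw 2 [← hV]
    rw [← hphi.isSymm]
    exact hphi.isPosSemidef.nonneg _
  rw [calQ1, add_apply, add_dotProduct]
  exact add_nonneg hcalQ ((hZ.isPosSemidef.smul (by norm_num)).nonneg V)

variable {Λ : Op d J} {γ τ : ℝ} {U F : Scalar d J}

theorem IsPosSemidef.etdStep_sub_self (hΛ : IsPosSemidef Λ) (hγ : 0 < γ) (hτ : 0 < τ)
    (U F : Scalar d J) :
    etdStep (Λ + γ • (1 : Op d J)) τ U (-F + γ • U) - U =
      phi1 (-(τ • (Λ + γ • (1 : Op d J)))) (-(τ • (F + Λ U))) := by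
  rw [Op.etdStep_sub_self (hΛ.add_smul_one hγ).isUnit hτ.ne', ← map_smul]
  congr 1
  simp only [add_apply, smul_apply, one_apply_eq_self]
  module

theorem IsPosSemidef.l2_etdStep_sub_self_le (hΛ : IsPosSemidef Λ) (hγ : 0 < γ) (hτ : 0 < τ)
    (U F : Scalar d J) :
    l2 (etdStep (Λ + γ • (1 : Op d J)) τ U (-F + γ • U) - U) ≤ τ * l2 (F + Λ U) := by
  rw [hΛ.etdStep_sub_self hγ hτ]
  refine (((hΛ.add_smul_one hγ).smul hτ).l2_phi1_neg_apply_le _).trans_eq ?_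
  rw [← neg_smul, l2_smul, abs_neg, abs_of_pos hτ]

/-- The left-hand side equals `-(γ / 2) |U' - U|²`. -/
theorem IsPosSemidef.etdStep_energy_le (hΛ : IsPosSemidef Λ) (hγ : 0 < γ) (hτ : 0 < τ)
    {U' : Scalar d J} (hU' : U' = etdStep (Λ + γ • (1 : Op d J)) τ U (-F + γ • U)) :
    F ⬝ᵥ (U' - U) + 1 / 2 * (Λ U' ⬝ᵥ U') - 1 / 2 * (Λ U ⬝ᵥ U)
      + 1 / τ * (calQ1 (τ • (Λ + γ • (1 : Op d J))) (U' - U) ⬝ᵥ (U' - U)) ≤ 0 := by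
  have hδ := hΛ.etdStep_sub_self hγ hτ U F
  rw [← hU'] at hδ
  set δ := U' - U
  have hcalQ : calQ1 (τ • (Λ + γ • (1 : Op d J))) δ ⬝ᵥ δ =
      τ * (-(F ⬝ᵥ δ) - Λ U ⬝ᵥ δ - 1 / 2 * (Λ δ ⬝ᵥ δ) - γ / 2 * (δ ⬝ᵥ δ)) := by
    rw [calQ1, add_apply]
    nth_rw 1 [hδ]
    rw [((hΛ.add_smul_one hγ).smul hτ).calQ_apply_phi1_neg, ← hδ]
    simp only [smul_apply, add_apply, one_apply_eq_self, add_dotProduct, sub_dotProduct,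
      neg_dotProduct, smul_dotProduct, smul_eq_mul]
    ring
  have hquad : Λ U' ⬝ᵥ U' = Λ U ⬝ᵥ U + 2 * (Λ U ⬝ᵥ δ) + Λ δ ⬝ᵥ δ := by
    have hsymm : Λ δ ⬝ᵥ U = Λ U ⬝ᵥ δ := by rw [hΛ.isSymm, dotProduct_comm]
    rw [show U' = U + δ by simp [δ], map_add, add_dotProduct, dotProduct_add, dotProduct_add, hsymm]
    ring
  rw [hcalQ, hquad, ← mul_assoc, one_div_mul_cancel hτ.ne', one_mul]
  have hdef : 0 ≤ γ / 2 * (δ ⬝ᵥ δ) :=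
    mul_nonneg (by positivity) (Finset.sum_nonneg fun x _ => mul_self_nonneg _)
  linarith

end Op

/-! ### Tensor fields -/

section Frob

variable {d : ℕ}

theorem frob_eq_norm (M : Matrix (Fin d) (Fin d) ℝ) :
    frob M = ‖(WithLp.toLp 2 fun p : Fin d × Fin d => M p.1 p.2 :
      EuclideanSpace ℝ (Fin d × Fin d))‖ := by
  rw [frob, EuclideanSpace.norm_eq]
  simp [Fintype.sum_prod_type]

theorem frob_nonneg (M : Matrix (Fin d) (Fin d) ℝ) : 0 ≤ frob M := Real.sqrt_nonneg _

theorem frob_sq (M : Matrix (Fin d) (Fin d) ℝ) : frob M ^ 2 = ∑ i, ∑ j, M i j ^ 2 :=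
  Real.sq_sqrt (Finset.sum_nonneg fun _ _ => Finset.sum_nonneg fun _ _ => sq_nonneg _)

theorem frob_add_le (M M' : Matrix (Fin d) (Fin d) ℝ) : frob (M + M') ≤ frob M + frob M' := by
  simp only [frob_eq_norm]
  exact norm_add_le (WithLp.toLp 2 fun p : Fin d × Fin d => M p.1 p.2)
    (WithLp.toLp 2 fun p : Fin d × Fin d => M' p.1 p.2)

theorem frob_neg (M : Matrix (Fin d) (Fin d) ℝ) : frob (-M) = frob M := by
  simp [frob]

theorem frob_smul (r : ℝ) (M : Matrix (Fin d) (Fin d) ℝ) : frob (r • M) = |r| * frob M := by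
  simp only [frob_eq_norm]
  exact norm_smul r (WithLp.toLp 2 fun p : Fin d × Fin d => M p.1 p.2)

theorem sum_mul_le_frob_mul_frob (M M' : Matrix (Fin d) (Fin d) ℝ) :
    ∑ i, ∑ j, M i j * M' i j ≤ frob M * frob M' := by
  rw [frob_eq_norm, frob_eq_norm, mul_comm]
  refine le_trans (le_of_eq ?_) (real_inner_le_norm _ _)
  simp [PiLp.inner_apply, Fintype.sum_prod_type]

end Frob

section TensorField

variable {d J : ℕ} [NeZero J]

theorem frob_le_supNorm (Φ : Tensor d J) (x : Grid d J) : frob (Φ x) ≤ supNorm Φ :=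
  Finset.le_sup' (fun x => frob (Φ x)) (Finset.mem_univ x)

theorem supNorm_le_iff {Φ : Tensor d J} {m : ℝ} : supNorm Φ ≤ m ↔ ∀ x, frob (Φ x) ≤ m := by
  simp [supNorm, Finset.sup'_le_iff]

/-- The grid function of one entry of a tensor field. -/
def entry (Φ : Tensor d J) (i j : Fin d) : Scalar d J := fun x => Φ x i j

/-- The exponential step `etdStep` acting on every entry of a tensor field. -/
def etdStepTensor (L : Op d J) (τ : ℝ) (Φ N : Tensor d J) : Tensor d J :=
  Op.onTensor (NormedSpace.exp (-(τ • L))) Φ + τ • Op.onTensor (phi1 (-(τ • L))) N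

theorem entry_etdStepTensor (L : Op d J) (τ : ℝ) (Φ N : Tensor d J) (i j : Fin d) :
    entry (etdStepTensor L τ Φ N) i j = etdStep L τ (entry Φ i j) (entry N i j) := rfl

theorem sum_mul_etdStepTensor (L : Op d J) (τ : ℝ) (W : Matrix (Fin d) (Fin d) ℝ)
    (Φ N : Tensor d J) (x : Grid d J) :
    ∑ i, ∑ j, W i j * etdStepTensor L τ Φ N x i j =
      etdStep L τ (fun y => ∑ i, ∑ j, W i j * Φ y i j) (fun y => ∑ i, ∑ j, W i j * N y i j) x := by
  have hpair : ∀ Ψ : Tensor d J,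
      (fun y => ∑ i, ∑ j, W i j * Ψ y i j) = ∑ i, ∑ j, W i j • entry Ψ i j := fun Ψ => by
    ext y
    simp only [Finset.sum_apply, Pi.smul_apply, smul_eq_mul, entry]
  rw [hpair Φ, hpair N, etdStep]
  simp only [map_sum, map_smul, Pi.add_apply, Pi.smul_apply, Finset.sum_apply, Finset.smul_sum,
    smul_eq_mul, ← Finset.sum_add_distrib]
  refine Finset.sum_congr rfl fun i _ => Finset.sum_congr rfl fun j _ => ?_
  rw [mul_left_comm τ, ← mul_add]
  rfl

/-- The maximum principle passes to the Frobenius norm by pairing the new field with its own value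
at the point in question. -/
theorem frob_etdStepTensor_le {L : Op d J} {τ γ m : ℝ} (hL : Op.IsMetzler (-L)) (hu : IsUnit L)
    (hτ : 0 < τ) (hLconst : ∀ r, L (Function.const _ r) = Function.const _ (γ * r)) (hm : 0 ≤ m)
    {Φ N : Tensor d J} (hΦ : ∀ x, frob (Φ x) ≤ m) (hN : ∀ x, frob (N x) ≤ γ * m)
    (x : Grid d J) : frob (etdStepTensor L τ Φ N x) ≤ m := by
  set W := etdStepTensor L τ Φ N x with hW
  have hsq : frob W ^ 2 ≤ frob W * m := by
    have hpair : frob W ^ 2 = ∑ i, ∑ j, W i j * etdStepTensor L τ Φ N x i j := by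
      rw [frob_sq, ← hW]
      simp only [sq]
    rw [hpair, sum_mul_etdStepTensor]
    refine Op.etdStep_le hL hu hτ (W := Function.const _ (frob W * m)) (fun y => ?_)
      (fun y => ?_) x
    · exact (sum_mul_le_frob_mul_frob _ _).trans
        (mul_le_mul_of_nonneg_left (hΦ y) (frob_nonneg _))
    · rw [hLconst, Function.const_apply, mul_left_comm]
      exact (sum_mul_le_frob_mul_frob _ _).trans
        (mul_le_mul_of_nonneg_left (hN y) (frob_nonneg _))
  rcases (frob_nonneg W).eq_or_lt with h0 | h0
  · rwa [← h0]
  · exact le_of_mul_le_mul_left (by rwa [← sq]) h0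

end TensorField

/-! ### Symmetric traceless tensor fields -/

section QTensor

variable {d J : ℕ}

theorem IsQTensor.add {Φ Ψ : Tensor d J} (hΦ : IsQTensor Φ) (hΨ : IsQTensor Ψ) :
    IsQTensor (Φ + Ψ) := fun x =>
  ⟨(hΦ x).1.add (hΨ x).1, by
    rw [Pi.add_apply, Matrix.trace_add, (hΦ x).2, (hΨ x).2, add_zero]⟩

theorem IsQTensor.smul {Φ : Tensor d J} (hΦ : IsQTensor Φ) (r : ℝ) : IsQTensor (r • Φ) := fun x =>
  ⟨(hΦ x).1.smul r, by rw [Pi.smul_apply, Matrix.trace_smul, (hΦ x).2, smul_zero]⟩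

theorem IsQTensor.neg {Φ : Tensor d J} (hΦ : IsQTensor Φ) : IsQTensor (-Φ) := fun x =>
  ⟨(hΦ x).1.neg, by rw [Pi.neg_apply, Matrix.trace_neg, (hΦ x).2, neg_zero]⟩

theorem trace_sub_trace_div_smul_one (hd : d ≠ 0) (M : Matrix (Fin d) (Fin d) ℝ) :
    (M - (M.trace / (d : ℝ)) • (1 : Matrix (Fin d) (Fin d) ℝ)).trace = 0 := by
  rw [Matrix.trace_sub, Matrix.trace_smul, Matrix.trace_one, Fintype.card_fin, smul_eq_mul,
    div_mul_cancel₀ _ (Nat.cast_ne_zero.mpr hd), sub_self]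

theorem dCentral_comm (h : ℝ) (k l : Fin d) (u : Scalar d J) :
    dCentral h k (dCentral h l u) = dCentral h l (dCentral h k u) := by
  ext x
  simp only [dCentral, LinearMap.smul_apply, LinearMap.sub_apply, Pi.smul_apply, Pi.sub_apply,
    shift_apply, smul_eq_mul, add_right_comm x (Pi.single k _) (Pi.single l _)]
  ring

theorem hessian_isSymm (h : ℝ) (u : Scalar d J) (x : Grid d J) : (hessian h u x).IsSymm :=
  Matrix.IsSymm.ext fun i j => congrFun (dCentral_comm h j i u) x

theorem IsQTensor.onTensor {Φ : Tensor d J} (hΦ : IsQTensor Φ) (L : Op d J) :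
    IsQTensor (Op.onTensor L Φ) := by
  intro x
  constructor
  · have hsymm : ∀ i j, entry Φ j i = entry Φ i j := fun i j => funext fun y => (hΦ y).1.apply i j
    exact Matrix.IsSymm.ext fun i j => congrFun (congrArg L (hsymm i j)) x
  · have htrace : ∑ i, entry Φ i i = 0 := by
      ext y
      rw [Finset.sum_apply]
      exact (hΦ y).2
    have h := congrFun (congrArg L htrace) x
    rwa [map_sum, map_zero, Finset.sum_apply] at h

theorem Params.forcing_isQTensor (p : Params) (hd : d ≠ 0) (h : ℝ) (u : Scalar d J) :
    IsQTensor (p.forcing h u) := by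
  intro x
  refine ⟨(((hessian_isSymm h u x).smul _).sub (Matrix.isSymm_one.smul _)).smul _, ?_⟩
  rw [forcing, Matrix.trace_smul, trace_sub_trace_div_smul_one hd, smul_zero]

theorem Params.varQ_isQTensor (p : Params) (hd : d ≠ 0) (h : ℝ) {Q : Tensor d J} (hQ : IsQTensor Q)
    (u : Scalar d J) : IsQTensor (p.varQ h Q u) := by
  intro x
  obtain ⟨hs, ht⟩ := hQ x
  obtain ⟨hfs, hft⟩ := p.forcing_isQTensor hd h u x
  refine ⟨((((hs.smul _).sub (((hs.pow 2).sub (Matrix.isSymm_one.smul _)).smul _)).add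
    (hs.smul _)).add hfs).add (hs.smul _), ?_⟩
  rw [varQ, Matrix.trace_add, Matrix.trace_add, Matrix.trace_add, Matrix.trace_sub,
    Matrix.trace_smul p.B, trace_sub_trace_div_smul_one hd, hft]
  simp only [Matrix.trace_smul, ht, smul_zero, sub_zero, add_zero]

variable [NeZero J]

theorem IsQTensor.etdStepTensor {Φ N : Tensor d J} (hΦ : IsQTensor Φ) (hN : IsQTensor N)
    (L : Op d J) (τ : ℝ) : IsQTensor (etdStepTensor L τ Φ N) :=
  (hΦ.onTensor _).add ((hN.onTensor _).smul τ)

theorem Params.stepQ_isQTensor (p : Params) (hd : d ≠ 0) (h τ κ₁ : ℝ) {Q : Tensor d J}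
    (hQ : IsQTensor Q) (u : Scalar d J) (s : ℝ) : IsQTensor (p.stepQ h τ κ₁ Q u s) :=
  hQ.etdStepTensor (((p.varQ_isQTensor hd h hQ u).smul _).neg.add (hQ.smul _)) _ _

theorem Params.IsNumericalSolution.isQTensor {p : Params} (hd : d ≠ 0) {h η₀ τ κ₁ κ₂ : ℝ}
    {Q₀ : Tensor d J} {u₀ : Scalar d J} {Q : ℕ → Tensor d J} {u : ℕ → Scalar d J} {s : ℕ → ℝ}
    (hsol : p.IsNumericalSolution h η₀ τ κ₁ κ₂ Q₀ u₀ Q u s) (hQ₀ : IsQTensor Q₀) (n : ℕ) :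
    IsQTensor (Q n) := by
  induction n with
  | zero => rwa [hsol.init_Q]
  | succ n ih =>
    rw [hsol.step_Q]
    exact p.stepQ_isQTensor hd h τ κ₁ ih _ _

end QTensor

section LowDimension

theorem trace_sq_eq_frob_sq {d : ℕ} {M : Matrix (Fin d) (Fin d) ℝ} (hM : M.IsSymm) :
    (M ^ 2).trace = frob M ^ 2 := by
  rw [frob_sq, sq, Matrix.trace]
  refine Finset.sum_congr rfl fun i _ => ?_
  rw [Matrix.diag_apply, Matrix.mul_apply]
  exact Finset.sum_congr rfl fun j _ => by rw [hM.apply i j, sq]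

theorem sq_sub_trace_eq_zero_of_dim_two {M : Matrix (Fin 2) (Fin 2) ℝ} (hM : M.IsSymm)
    (ht : M.trace = 0) :
    M ^ 2 - ((M ^ 2).trace / ((2 : ℕ) : ℝ)) • (1 : Matrix (Fin 2) (Fin 2) ℝ) = 0 := by
  have h10 : M 1 0 = M 0 1 := hM.apply 0 1
  have h11 : M 1 1 = -M 0 0 := by rw [Matrix.trace_fin_two] at ht; linarith
  ext i j
  fin_cases i <;> fin_cases j <;>
    simp [sq, Matrix.mul_apply, Fin.sum_univ_two, Matrix.trace_fin_two, h10, h11] <;> ring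

theorem frob_sq_sub_trace_of_dim_three {M : Matrix (Fin 3) (Fin 3) ℝ} (hM : M.IsSymm)
    (ht : M.trace = 0) :
    frob (M ^ 2 - ((M ^ 2).trace / ((3 : ℕ) : ℝ)) • (1 : Matrix (Fin 3) (Fin 3) ℝ))
      = frob M ^ 2 / √6 := by
  have h10 : M 1 0 = M 0 1 := hM.apply 0 1
  have h20 : M 2 0 = M 0 2 := hM.apply 0 2
  have h21 : M 2 1 = M 1 2 := hM.apply 1 2
  have h22 : M 2 2 = -M 0 0 - M 1 1 := by rw [Matrix.trace_fin_three] at ht; linarith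
  have hsq : frob (M ^ 2 - ((M ^ 2).trace / ((3 : ℕ) : ℝ)) • (1 : Matrix (Fin 3) (Fin 3) ℝ)) ^ 2
      = (frob M ^ 2 / √6) ^ 2 := by
    rw [div_pow, Real.sq_sqrt (by norm_num), frob_sq, frob_sq]
    simp [sq, Matrix.mul_apply, Fin.sum_univ_three, Matrix.trace_fin_three, h10, h20, h21, h22]
    ring
  exact (pow_left_inj₀ (frob_nonneg _) (by positivity) two_ne_zero).mp hsq

end LowDimension

/-! ### The maximum bound principle -/

namespace Params

/-- Conditions on the parameters weaker than `Admissible`: `K` and `B₀` may vanish, `B` and `q` are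
arbitrary, and in dimension three `s₊` need only be the quotient of a real root, and nonzero. -/
structure WeaklyAdmissible (p : Params) (d : ℕ) : Prop where
  K_nonneg : 0 ≤ p.K
  C_pos : 0 < p.C
  c_pos : 0 < p.c
  B0_nonneg : 0 ≤ p.B0
  regime : (d = 2 ∧ p.A < 0) ∨ (d = 3 ∧ 24 * p.A * p.C ≤ p.B ^ 2 ∧ p.sPlus d ≠ 0)

section

variable {p : Params} {d : ℕ}

theorem Admissible.weaklyAdmissible (hp : p.Admissible d) : p.WeaklyAdmissible d where
  K_nonneg := hp.K_pos.le
  C_pos := hp.C_pos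
  c_pos := hp.c_pos
  B0_nonneg := hp.B0_pos.le
  regime := hp.regime.imp_right fun ⟨hd, hA⟩ => by
    have hB := hp.B_pos
    have hC := hp.C_pos
    rw [lt_div_iff₀ (by positivity)] at hA
    refine ⟨hd, by nlinarith [sq_nonneg p.B], ?_⟩
    rw [sPlus, if_neg (by omega)]
    positivity

theorem WeaklyAdmissible.dim_eq (hp : p.WeaklyAdmissible d) : d = 2 ∨ d = 3 :=
  hp.regime.imp And.left And.left

theorem WeaklyAdmissible.dim_ne_zero (hp : p.WeaklyAdmissible d) : d ≠ 0 := by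
  rcases hp.dim_eq with rfl | rfl <;> decide

theorem bCoeff_nonneg (p : Params) (d : ℕ) : 0 ≤ p.bCoeff d := by
  unfold bCoeff
  split_ifs <;> positivity

theorem frob_smul_sq_sub_trace_le (p : Params) (hd : d = 2 ∨ d = 3) {M : Matrix (Fin d) (Fin d) ℝ}
    (hM : M.IsSymm) (ht : M.trace = 0) :
    frob (p.B • (M ^ 2 - ((M ^ 2).trace / (d : ℝ)) • (1 : Matrix (Fin d) (Fin d) ℝ)))
      ≤ p.bCoeff d * frob M ^ 2 := by
  rw [frob_smul]
  rcases hd with rfl | rfl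
  · rw [sq_sub_trace_eq_zero_of_dim_two hM ht]
    simp [frob, bCoeff]
  · rw [frob_sq_sub_trace_of_dim_three hM ht, bCoeff, if_neg (by decide), div_mul_eq_mul_div,
      mul_div_assoc]

theorem deriv_le_kappa0 (p : Params) (d : ℕ) (Amax : ℝ) {η ξ : ℝ} (hξ : ξ ∈ Set.Icc 0 η) :
    p.A - 2 * p.bCoeff d * ξ + 3 * p.C * ξ ^ 2 ≤ p.kappa0 d Amax η := by
  refine le_trans (le_csSup ?_ (Set.mem_image_of_mem
    (fun ξ : ℝ => p.A - 2 * p.bCoeff d * ξ + 3 * p.C * ξ ^ 2) hξ)) (le_max_right _ _)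
  exact (isCompact_Icc.image (by fun_prop)).bddAbove

theorem hasDerivAt_mul_add_fPoly (p : Params) (d : ℕ) (κ S ξ : ℝ) :
    HasDerivAt (fun ξ => κ * ξ + p.fPoly d S ξ)
      (κ - (p.A - 2 * p.bCoeff d * ξ + 3 * p.C * ξ ^ 2)) ξ := by
  have hlin := ((hasDerivAt_id ξ).const_mul κ).add ((hasDerivAt_id ξ).const_mul (-p.A))
  have hpoly := (hlin.add ((hasDerivAt_pow 2 ξ).const_mul (p.bCoeff d))).sub
    ((hasDerivAt_pow 3 ξ).const_mul p.C) |>.add_const S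
  convert! hpoly using 1
  · ext ζ
    simp only [fPoly, Pi.add_apply, Pi.sub_apply, id]
    ring
  · push_cast
    ring

/-- `κ₀` dominates the derivative of `-f_d`, so `ξ ↦ κ ξ + f_d ξ` increases on `[0, η]`. -/
theorem mul_add_fPoly_le {Amax η S κ r : ℝ} (hκ : p.kappa0 d Amax η ≤ κ)
    (hf : p.fPoly d S η ≤ 0) (hr : r ∈ Set.Icc 0 η) : κ * r + p.fPoly d S r ≤ κ * η := by
  have hder := p.hasDerivAt_mul_add_fPoly d κ S
  have hmono : MonotoneOn (fun ξ => κ * ξ + p.fPoly d S ξ) (Set.Icc 0 η) := by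
    refine monotoneOn_of_deriv_nonneg (convex_Icc 0 η)
      (fun ξ _ => (hder ξ).continuousAt.continuousWithinAt)
      (fun ξ _ => (hder ξ).differentiableAt.differentiableWithinAt) fun ξ hξ => ?_
    rw [(hder ξ).deriv]
    linarith [p.deriv_le_kappa0 d Amax (interior_subset hξ)]
  have hle : κ * r + p.fPoly d S r ≤ κ * η + p.fPoly d S η :=
    hmono hr ⟨hr.1.trans hr.2, le_rfl⟩ hr.2
  linarith

theorem exists_fPoly_nonpos (p : Params) (d : ℕ) (hC : 0 < p.C) (S : ℝ) :
    ∃ ηmin : ℝ, 0 < ηmin ∧ ∀ η : ℝ, ηmin ≤ η → p.fPoly d S η ≤ 0 := by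
  have hb := p.bCoeff_nonneg d
  have hquot : 0 ≤ (|p.A| + p.bCoeff d + |S|) / p.C := by positivity
  refine ⟨1 + (|p.A| + p.bCoeff d + |S|) / p.C, by positivity, fun η hη => ?_⟩
  have hη1 : 1 ≤ η := by linarith
  have hdom : |p.A| + p.bCoeff d + |S| ≤ p.C * η := by
    rw [← div_le_iff₀' hC]
    linarith
  have hlin : -p.A * η ≤ |p.A| * η ^ 2 :=
    mul_le_mul (neg_le_abs _) (le_self_pow₀ hη1 two_ne_zero) (by positivity) (abs_nonneg _)
  have hconst : S ≤ |S| * η ^ 2 :=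
    (le_abs_self S).trans (le_mul_of_one_le_right (abs_nonneg _) (one_le_pow₀ hη1))
  have hcube := mul_le_mul_of_nonneg_right hdom (sq_nonneg η)
  unfold fPoly
  linarith

end

variable {p : Params} {d J : ℕ}

theorem le_aTilde (p : Params) (hB0 : 0 ≤ p.B0) (u : Scalar d J) (x : Grid d J) :
    p.A ≤ p.aTilde u x :=
  le_add_of_nonneg_right (by positivity)

theorem stabilized_varQ_eq (p : Params) {h κ : ℝ} {Q : Tensor d J} {u : Scalar d J} {x : Grid d J}
    (hs : (Q x).IsSymm) :
    -p.varQ h Q u x + κ • Q x =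
      (κ - p.aTilde u x - p.C * frob (Q x) ^ 2) • Q x
      + p.B • (Q x ^ 2 - ((Q x ^ 2).trace / (d : ℝ)) • (1 : Matrix (Fin d) (Fin d) ℝ))
      + -p.forcing h u x := by
  rw [varQ, ← trace_sq_eq_frob_sq hs, aTilde]
  module

variable [NeZero J]

theorem WeaklyAdmissible.frob_stabilized_varQ_le (hp : p.WeaklyAdmissible d) {h Amax η S κ : ℝ}
    {Q : Tensor d J} {u : Scalar d J} (hQ : IsQTensor Q) (hκ : p.kappa0 d Amax η ≤ κ)
    (hf : p.fPoly d S η ≤ 0) (hS : supNorm (p.forcing h u) ≤ S) (hA : ∀ x, p.aTilde u x ≤ Amax)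
    {x : Grid d J} (hη : frob (Q x) ≤ η) :
    frob (-p.varQ h Q u x + κ • Q x) ≤ κ * η := by
  obtain ⟨hs, ht⟩ := hQ x
  have hr := frob_nonneg (Q x)
  have hcoef : 0 ≤ κ - p.aTilde u x - p.C * frob (Q x) ^ 2 := by
    have hmax : Amax + p.C * η ^ 2 ≤ κ := (le_max_left _ _).trans hκ
    have hsq := mul_le_mul_of_nonneg_left (pow_le_pow_left₀ hr hη 2) hp.C_pos.le
    linarith [hA x]
  have hfrob : frob (-p.varQ h Q u x + κ • Q x) ≤
      (κ - p.aTilde u x - p.C * frob (Q x) ^ 2) * frob (Q x) + p.bCoeff d * frob (Q x) ^ 2 + S := by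
    rw [p.stabilized_varQ_eq hs]
    refine (frob_add_le _ _).trans (add_le_add ((frob_add_le _ _).trans (add_le_add ?_
      (p.frob_smul_sq_sub_trace_le hp.dim_eq hs ht))) ?_)
    · rw [frob_smul, abs_of_nonneg hcoef]
    · rw [frob_neg]
      exact (frob_le_supNorm _ x).trans hS
  have hpoly := mul_add_fPoly_le hκ hf ⟨hr, hη⟩
  have hAr := mul_le_mul_of_nonneg_right (p.le_aTilde hp.B0_nonneg u x) hr
  unfold fPoly at hpoly
  linarith

theorem gFactor_pos (p : Params) (h : ℝ) (Q : Tensor d J) (u : Scalar d J) (s : ℝ) :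
    0 < p.gFactor h Q u s := div_pos (Real.exp_pos _) (Real.exp_pos _)

theorem gFactor_eq (p : Params) (h : ℝ) (Q : Tensor d J) (u : Scalar d J) (s : ℝ) :
    p.gFactor h Q u s = Real.exp (s - p.energy1 h Q u) := (Real.exp_sub _ _).symm

theorem isPosSemidef_neg_smul_laplacian (p : Params) (hK : 0 ≤ p.K) (h : ℝ) :
    Op.IsPosSemidef (-(p.K • laplacian h) : Op d J) :=
  smul_neg p.K (laplacian h : Op d J) ▸ (Op.isPosSemidef_neg_laplacian h).smul hK

theorem isMetzler_neg_opQ (p : Params) (hK : 0 ≤ p.K) (h g κ₁ : ℝ) :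
    Op.IsMetzler (-p.opQ h g κ₁ : Op d J) := by
  have heq : (-p.opQ h g κ₁ : Op d J) = p.K • laplacian h - (g * κ₁) • 1 := by
    rw [opQ]
    module
  rw [heq]
  exact ((Op.isMetzler_laplacian h).smul hK).sub_smul_one _

theorem opQ_const (p : Params) (h g κ₁ r : ℝ) :
    p.opQ h g κ₁ (Function.const (Grid d J) r) = Function.const _ (g * κ₁ * r) := by
  have hlap : (p.K • laplacian h : Op d J) (Function.const _ r) = 0 := by
    rw [smul_apply, laplacian_const, smul_zero]
  ext x
  simp [opQ, hlap]

theorem WeaklyAdmissible.supNorm_stepQ_le (hp : p.WeaklyAdmissible d) {h τ κ₁ Amax η S G s : ℝ}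
    {Q : Tensor d J} {u : Scalar d J} (hQ : IsQTensor Q) (hτ : 0 < τ) (hκ₁ : 0 < κ₁)
    (hκ : p.kappa0 d Amax η ≤ κ₁) (hf : p.fPoly d S η ≤ 0)
    (hb : p.LevelBounds h G S Amax Q u s) (hQη : supNorm Q ≤ η) :
    supNorm (p.stepQ h τ κ₁ Q u s) ≤ η := by
  have hg := p.gFactor_pos h Q u s
  rw [supNorm_le_iff] at hQη ⊢
  have hη : 0 ≤ η := (frob_nonneg _).trans (hQη 0)
  refine frob_etdStepTensor_le (p.isMetzler_neg_opQ hp.K_nonneg h _ κ₁)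
    ((p.isPosSemidef_neg_smul_laplacian hp.K_nonneg h).add_smul_one (mul_pos hg hκ₁)).isUnit hτ
    (p.opQ_const h _ κ₁) hη hQη fun x => ?_
  have hstab := hp.frob_stabilized_varQ_le hQ hκ hf hb.forcing_le hb.aTilde_le (hQη x)
  have hsplit : (-(p.gFactor h Q u s • p.varQ h Q u) + (p.gFactor h Q u s * κ₁) • Q) x
      = p.gFactor h Q u s • (-p.varQ h Q u x + κ₁ • Q x) := by
    simp only [Pi.add_apply, Pi.neg_apply, Pi.smul_apply]
    module
  rw [hsplit, frob_smul, abs_of_pos hg, mul_assoc]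
  exact mul_le_mul_of_nonneg_left hstab hg.le

theorem IsNumericalSolution.supNorm_le (hp : p.WeaklyAdmissible d) {h η₀ τ κ₁ κ₂ : ℝ}
    {Q₀ : Tensor d J} {u₀ : Scalar d J} {Q : ℕ → Tensor d J} {u : ℕ → Scalar d J} {s : ℕ → ℝ}
    (hsol : p.IsNumericalSolution h η₀ τ κ₁ κ₂ Q₀ u₀ Q u s) (hQ₀ : IsQTensor Q₀)
    (hτ : 0 < τ) (hκ₁ : 0 < κ₁) {N : ℕ∞} {G S Amax η : ℝ} (hG : 0 < G)
    (hb : ∀ n : ℕ, (n : ℕ∞) < N → p.LevelBounds h G S Amax (Q n) (u n) (s n))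
    (hf : p.fPoly d S η ≤ 0) (hQη : supNorm Q₀ ≤ η)
    (hκ : p.kappa0 d Amax η / G ≤ κ₁) (n : ℕ) (hn : (n : ℕ∞) ≤ N) : supNorm (Q n) ≤ η := by
  induction n with
  | zero => rwa [hsol.init_Q]
  | succ n ih =>
    have hlt : (n : ℕ∞) < N := lt_of_lt_of_le (by exact_mod_cast n.lt_succ_self) hn
    -- `g⁰ = 1` because `s⁰ = E_{1h}(Q⁰, u⁰)`
    have hG1 : G ≤ 1 := by
      have hg0 := (hb 0 (hlt.trans_le' (by simp))).le_g
      rwa [gFactor_eq, hsol.init_s, hsol.init_Q, hsol.init_u, sub_self, Real.exp_zero] at hg0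
    have hκ' : p.kappa0 d Amax η ≤ κ₁ :=
      ((div_le_iff₀ hG).mp hκ).trans (mul_le_of_le_one_right hκ₁.le hG1)
    rw [hsol.step_Q]
    exact hp.supNorm_stepQ_le (hsol.isQTensor hp.dim_ne_zero hQ₀ n) hτ hκ₁ hκ' hf (hb n hlt)
      (ih hlt.le)

end Params

/-! ### The modified energy law -/

section

variable {d J : ℕ} [NeZero J]

theorem inner_eq (h : ℝ) (U V : Scalar d J) : inner h U V = h ^ d * (U ⬝ᵥ V) := rfl

theorem innerT_eq (h : ℝ) (Φ Ψ : Tensor d J) :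
    innerT h Φ Ψ = h ^ d * ∑ i, ∑ j, entry Φ i j ⬝ᵥ entry Ψ i j := by
  simp only [Finset.mul_sum]
  rfl

theorem inner_smul_left (h r : ℝ) (U V : Scalar d J) : inner h (r • U) V = r * inner h U V := by
  rw [inner_eq, inner_eq, smul_dotProduct, smul_eq_mul, mul_left_comm]

theorem innerT_smul_left (h r : ℝ) (Φ Ψ : Tensor d J) :
    innerT h (r • Φ) Ψ = r * innerT h Φ Ψ := by
  simp only [innerT, Finset.mul_sum]
  exact Finset.sum_congr rfl fun i _ => Finset.sum_congr rfl fun j _ =>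
    inner_smul_left h r (entry Φ i j) (entry Ψ i j)

theorem innerT_onTensor_self_nonneg {h : ℝ} (hh : 0 ≤ h) {L : Op d J}
    (hL : ∀ U, 0 ≤ L U ⬝ᵥ U) (Φ : Tensor d J) : 0 ≤ innerT h (L.onTensor Φ) Φ := by
  rw [innerT_eq]
  exact mul_nonneg (pow_nonneg hh d)
    (Finset.sum_nonneg fun i _ => Finset.sum_nonneg fun j _ => hL (entry Φ i j))

namespace Op

variable {Λ : Op d J} {γ τ h : ℝ}

theorem IsPosSemidef.inner_etdStep_energy_le (hΛ : IsPosSemidef Λ) (hγ : 0 < γ) (hτ : 0 < τ)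
    (hh : 0 ≤ h) {U U' F : Scalar d J}
    (hU' : U' = etdStep (Λ + γ • (1 : Op d J)) τ U (-F + γ • U)) :
    inner h F (U' - U) + 1 / 2 * inner h (Λ U') U' - 1 / 2 * inner h (Λ U) U
      + 1 / τ * inner h (calQ1 (τ • (Λ + γ • (1 : Op d J))) (U' - U)) (U' - U) ≤ 0 := by
  have hle := mul_nonpos_of_nonneg_of_nonpos (pow_nonneg hh d) (hΛ.etdStep_energy_le hγ hτ hU')
  simp only [inner_eq]
  linarith

theorem IsPosSemidef.innerT_etdStepTensor_energy_le (hΛ : IsPosSemidef Λ) (hγ : 0 < γ)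
    (hτ : 0 < τ) (hh : 0 ≤ h) {Q Q' F : Tensor d J}
    (hQ' : Q' = etdStepTensor (Λ + γ • (1 : Op d J)) τ Q (-F + γ • Q)) :
    innerT h F (Q' - Q) + 1 / 2 * innerT h (Λ.onTensor Q') Q'
      - 1 / 2 * innerT h (Λ.onTensor Q) Q
      + 1 / τ * innerT h ((calQ1 (τ • (Λ + γ • (1 : Op d J)))).onTensor (Q' - Q)) (Q' - Q)
      ≤ 0 := by
  have hentry (i j : Fin d) := hΛ.inner_etdStep_energy_le hγ hτ hh (F := entry F i j)
    ((congrArg (entry · i j) hQ').trans (entry_etdStepTensor _ τ Q _ i j))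
  have hsum := Finset.sum_nonpos fun i (_ : i ∈ Finset.univ) =>
    Finset.sum_nonpos fun j (_ : j ∈ Finset.univ) => hentry i j
  simp only [Finset.sum_add_distrib, Finset.sum_sub_distrib, ← Finset.mul_sum] at hsum
  exact hsum

end Op

end

namespace Params

variable {p : Params} {d J : ℕ} [NeZero J] {h τ κ₁ κ₂ η₀ s s' : ℝ} {Q Q' : Tensor d J}
  {u u' : Scalar d J}

theorem isPosSemidef_smul_laplacian_mul_self (p : Params) (hB0 : 0 ≤ p.B0) (h : ℝ) :
    Op.IsPosSemidef ((2 * p.B0) • (laplacian h * laplacian h) : Op d J) :=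
  (Op.isSymm_laplacian h).isPosSemidef_mul_self.smul (by positivity)

/-- The modified energy: the quadratic part of the discrete energy, with the auxiliary variable `s`
in place of `E_{1h}(Q, u)`. -/
def modEnergy (p : Params) (h : ℝ) (Q : Tensor d J) (u : Scalar d J) (s : ℝ) : ℝ :=
  1 / 2 * innerT h (Op.onTensor (-(p.K • laplacian h)) Q) Q
    + 1 / 2 * inner h (((2 * p.B0) • (laplacian h * laplacian h) : Op d J) u) u + s

theorem le_modEnergy (hK : 0 ≤ p.K) (hB0 : 0 ≤ p.B0) (hh : 0 ≤ h) (Q : Tensor d J)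
    (u : Scalar d J) (s : ℝ) : s ≤ p.modEnergy h Q u s := by
  have hQ := innerT_onTensor_self_nonneg hh (p.isPosSemidef_neg_smul_laplacian hK h).nonneg Q
  have hu := mul_nonneg (pow_nonneg hh d) ((p.isPosSemidef_smul_laplacian_mul_self hB0 h).nonneg u)
  rw [← inner_eq] at hu
  unfold modEnergy
  linarith

theorem dissipation_nonneg (hK : 0 ≤ p.K) (hB0 : 0 ≤ p.B0) (hh : 0 ≤ h) (hτ : 0 < τ)
    (hκ₁ : 0 < κ₁) (hκ₂ : 0 < κ₂) (Q : Tensor d J) (u : Scalar d J) (s : ℝ) (Q' : Tensor d J)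
    (u' : Scalar d J) : 0 ≤ p.dissipation h τ κ₁ κ₂ Q u s Q' u' := by
  have hg := p.gFactor_pos h Q u s
  have hL := ((p.isPosSemidef_neg_smul_laplacian (d := d) (J := J) hK h).add_smul_one
    (mul_pos hg hκ₁)).smul hτ
  have hD := ((p.isPosSemidef_smul_laplacian_mul_self (d := d) (J := J) hB0 h).add_smul_one
    (mul_pos hg hκ₂)).smul hτ
  exact mul_nonneg (one_div_pos.mpr hτ).le (add_nonneg
    (innerT_onTensor_self_nonneg hh hL.calQ1_dotProduct_nonneg _)
    (mul_nonneg (pow_nonneg hh d) (hD.calQ1_dotProduct_nonneg _)))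

theorem provisionalS_eq (p : Params) (h : ℝ) (Q : Tensor d J) (u : Scalar d J) (s : ℝ)
    (Q' : Tensor d J) (u' : Scalar d J) :
    p.provisionalS h Q u s Q' u' = s + (innerT h (p.gFactor h Q u s • p.varQ h Q u) (Q' - Q)
      + inner h (p.gFactor h Q u s • p.varU h Q u) (u' - u)) := by
  rw [innerT_smul_left, inner_smul_left, ← mul_add]
  rfl

theorem modEnergy_step_le (hK : 0 ≤ p.K) (hB0 : 0 ≤ p.B0) (hh : 0 ≤ h) (hτ : 0 < τ)
    (hκ₁ : 0 < κ₁) (hκ₂ : 0 < κ₂) (hητ : η₀ * τ ≤ 1) (hQ' : Q' = p.stepQ h τ κ₁ Q u s)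
    (hu' : u' = p.stepU h τ κ₂ Q u s)
    (hs' : s' - p.provisionalS h Q u s Q' u' ≤ η₀ * τ * p.dissipation h τ κ₁ κ₂ Q u s Q' u') :
    p.modEnergy h Q' u' s' ≤ p.modEnergy h Q u s := by
  have hg := p.gFactor_pos h Q u s
  have hstepQ := (p.isPosSemidef_neg_smul_laplacian hK h).innerT_etdStepTensor_energy_le
    (mul_pos hg hκ₁) hτ hh (F := p.gFactor h Q u s • p.varQ h Q u) hQ'
  have hstepU := (p.isPosSemidef_smul_laplacian_mul_self hB0 h).inner_etdStep_energy_le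
    (mul_pos hg hκ₂) hτ hh (F := p.gFactor h Q u s • p.varU h Q u) hu'
  have hrelax := hs'.trans (mul_le_of_le_one_left
    (dissipation_nonneg hK hB0 hh hτ hκ₁ hκ₂ Q u s Q' u') hητ)
  rw [provisionalS_eq, dissipation] at hrelax
  unfold modEnergy
  unfold opQ opU at hrelax
  linarith

theorem IsNumericalSolution.le_modEnergy (hK : 0 ≤ p.K) (hB0 : 0 ≤ p.B0) (hh : 0 ≤ h)
    (hτ : 0 < τ) (hκ₁ : 0 < κ₁) (hκ₂ : 0 < κ₂) (hητ : η₀ * τ ≤ 1) {Q₀ : Tensor d J}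
    {u₀ : Scalar d J} {Q : ℕ → Tensor d J} {u : ℕ → Scalar d J} {s : ℕ → ℝ}
    (hsol : p.IsNumericalSolution h η₀ τ κ₁ κ₂ Q₀ u₀ Q u s) (n : ℕ) :
    s n ≤ p.modEnergy h Q₀ u₀ (p.energy1 h Q₀ u₀) := by
  have hanti : Antitone fun n => p.modEnergy h (Q n) (u n) (s n) :=
    antitone_nat_of_succ_le fun n => by
      obtain ⟨ξ, -, -, hs⟩ := hsol.step_s n
      exact modEnergy_step_le hK hB0 hh hτ hκ₁ hκ₂ hητ (hsol.step_Q n) (hsol.step_u n) hs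
  have hdecay : p.modEnergy h (Q n) (u n) (s n) ≤ p.modEnergy h (Q 0) (u 0) (s 0) :=
    hanti n.zero_le
  rw [hsol.init_Q, hsol.init_u, hsol.init_s] at hdecay
  exact (Params.le_modEnergy hK hB0 hh (Q n) (u n) (s n)).trans hdecay

end Params

/-! ### Polynomial growth and coercivity -/

section

variable {d J : ℕ} [NeZero J]

theorem abs_apply_le_l2 (U : Scalar d J) (x : Grid d J) : |U x| ≤ l2 U :=
  PiLp.norm_apply_le (WithLp.toLp 2 U : EuclideanSpace ℝ (Grid d J)) x

/-- The size of a state `(Q, u)`: the sum of the `ℓ²` norms of all its components. -/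
def size (Q : Tensor d J) (u : Scalar d J) : ℝ := ∑ i, ∑ j, l2 (entry Q i j) + l2 u

theorem size_nonneg (Q : Tensor d J) (u : Scalar d J) : 0 ≤ size Q u :=
  add_nonneg (Finset.sum_nonneg fun _ _ => Finset.sum_nonneg fun _ _ => l2_nonneg _) (l2_nonneg _)

theorem l2_entry_le_size (Q : Tensor d J) (u : Scalar d J) (i j : Fin d) :
    l2 (entry Q i j) ≤ size Q u := by
  refine le_add_of_le_of_nonneg ?_ (l2_nonneg u)
  exact (Finset.single_le_sum (f := fun j => l2 (entry Q i j)) (fun _ _ => l2_nonneg _)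
    (Finset.mem_univ j)).trans (Finset.single_le_sum (f := fun i => ∑ j, l2 (entry Q i j))
      (fun _ _ => Finset.sum_nonneg fun _ _ => l2_nonneg _) (Finset.mem_univ i))

theorem l2_le_size (Q : Tensor d J) (u : Scalar d J) : l2 u ≤ size Q u :=
  le_add_of_nonneg_left (Finset.sum_nonneg fun _ _ => Finset.sum_nonneg fun _ _ => l2_nonneg _)

theorem size_le_of_forall_le {Q : Tensor d J} {u : Scalar d J} {r : ℝ}
    (hQ : ∀ i j, l2 (entry Q i j) ≤ r) (hu : l2 u ≤ r) : size Q u ≤ ((d : ℝ) ^ 2 + 1) * r := by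
  refine (add_le_add (Finset.sum_le_sum fun i _ => Finset.sum_le_sum fun j _ => hQ i j)
    hu).trans_eq ?_
  simp only [Finset.sum_const, Finset.card_univ, Fintype.card_fin, nsmul_eq_mul]
  ring

theorem size_smul (r : ℝ) (Q : Tensor d J) (u : Scalar d J) :
    size (r • Q) (r • u) = |r| * size Q u := by
  simp only [size, mul_add, Finset.mul_sum, ← l2_smul]
  rfl

theorem size_le_add_size_sub (Q Q' : Tensor d J) (u u' : Scalar d J) :
    size Q' u' ≤ size Q u + size (Q' - Q) (u' - u) := by
  have hl2 (U V : Scalar d J) : l2 V ≤ l2 U + l2 (V - U) := by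
    simpa only [add_sub_cancel] using l2_add_le U (V - U)
  have hQ : ∑ i, ∑ j, l2 (entry Q' i j)
      ≤ ∑ i, ∑ j, l2 (entry Q i j) + ∑ i, ∑ j, l2 (entry (Q' - Q) i j) := by
    simp only [← Finset.sum_add_distrib]
    exact Finset.sum_le_sum fun i _ => Finset.sum_le_sum fun j _ => hl2 _ _
  unfold size
  linarith [hl2 u u']

theorem abs_innerT_add_inner_le {h : ℝ} (hh : 0 ≤ h) (Φ Ψ : Tensor d J) (U V : Scalar d J) :
    |innerT h Φ Ψ + inner h U V| ≤ h ^ d * (size Φ U * size Ψ V) := by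
  rw [innerT_eq, inner_eq, ← mul_add, abs_mul, abs_of_nonneg (pow_nonneg hh d)]
  refine mul_le_mul_of_nonneg_left ?_ (pow_nonneg hh d)
  have hΦ (i j : Fin d) : |entry Φ i j ⬝ᵥ entry Ψ i j| ≤ l2 (entry Φ i j) * size Ψ V :=
    (abs_dotProduct_le _ _).trans
      (mul_le_mul_of_nonneg_left (l2_entry_le_size Ψ V i j) (l2_nonneg _))
  have hU : |U ⬝ᵥ V| ≤ l2 U * size Ψ V :=
    (abs_dotProduct_le _ _).trans (mul_le_mul_of_nonneg_left (l2_le_size Ψ V) (l2_nonneg _))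
  rw [size, add_mul, Finset.sum_mul]
  refine (abs_add_le _ _).trans (add_le_add ((Finset.abs_sum_le_sum_abs _ _).trans
    (Finset.sum_le_sum fun i _ => ?_)) hU)
  rw [Finset.sum_mul]
  exact (Finset.abs_sum_le_sum_abs _ _).trans (Finset.sum_le_sum fun j _ => hΦ i j)

theorem l2_pow_four_le (U : Scalar d J) :
    l2 U ^ 4 ≤ Fintype.card (Grid d J) * ∑ x, U x ^ 4 := by
  calc l2 U ^ 4 = (∑ x, U x ^ 2) ^ 2 := by
        rw [show 4 = 2 * 2 from rfl, pow_mul, l2_sq]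
        simp only [dotProduct, sq]
    _ ≤ Fintype.card (Grid d J) * ∑ x, (U x ^ 2) ^ 2 := sq_sum_le_card_mul_sum_sq
    _ = Fintype.card (Grid d J) * ∑ x, U x ^ 4 := by simp only [← pow_mul]

theorem apply_pow_four_le_frob (M : Matrix (Fin d) (Fin d) ℝ) (i j : Fin d) :
    M i j ^ 4 ≤ frob M ^ 4 := by
  have hle : M i j ^ 2 ≤ frob M ^ 2 := by
    rw [frob_sq]
    exact (Finset.single_le_sum (f := fun j => M i j ^ 2) (fun _ _ => sq_nonneg _)
      (Finset.mem_univ j)).trans (Finset.single_le_sum (f := fun i => ∑ j, M i j ^ 2)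
        (fun _ _ => Finset.sum_nonneg fun _ _ => sq_nonneg _) (Finset.mem_univ i))
  simpa only [← pow_mul] using pow_le_pow_left₀ (sq_nonneg _) hle 2

theorem exists_size_pow_four_le (d J : ℕ) [NeZero J] :
    ∃ c : ℝ, 0 < c ∧ ∀ (Q : Tensor d J) (u : Scalar d J),
      c * size Q u ^ 4 ≤ ∑ x, (frob (Q x) ^ 4 + u x ^ 4) := by
  have hN : (0 : ℝ) < Fintype.card (Grid d J) := Nat.cast_pos.mpr Fintype.card_pos
  refine ⟨(((d : ℝ) ^ 2 + 1) ^ 4 * Fintype.card (Grid d J))⁻¹, by positivity, fun Q u => ?_⟩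
  set W := ∑ x, (frob (Q x) ^ 4 + u x ^ 4)
  set r := √√(Fintype.card (Grid d J) * W)
  have hr : r ^ 4 = Fintype.card (Grid d J) * W := by
    rw [show 4 = 2 * 2 from rfl, pow_mul, Real.sq_sqrt (Real.sqrt_nonneg _), Real.sq_sqrt]
    positivity
  have hle {U : Scalar d J} (hU : ∀ x, U x ^ 4 ≤ frob (Q x) ^ 4 + u x ^ 4) : l2 U ≤ r := by
    refine le_of_pow_le_pow_left₀ four_ne_zero (Real.sqrt_nonneg _) ?_
    rw [hr]
    exact (l2_pow_four_le U).trans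
      (mul_le_mul_of_nonneg_left (Finset.sum_le_sum fun x _ => hU x) hN.le)
  have hsize : size Q u ≤ ((d : ℝ) ^ 2 + 1) * r :=
    size_le_of_forall_le
      (fun i j => hle fun x => (apply_pow_four_le_frob (Q x) i j).trans
        (le_add_of_nonneg_right (by positivity)))
      (hle fun x => le_add_of_nonneg_left (by positivity))
  rw [inv_mul_le_iff₀ (by positivity), mul_assoc, ← hr, ← mul_pow]
  exact pow_le_pow_left₀ (size_nonneg Q u) hsize 4

/-- `F` grows at most like the `k`-th power of the size of the state. -/
abbrev HasGrowth {E : Type*} [NormedAddCommGroup E] (k : ℕ) (F : Tensor d J × Scalar d J → E) :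
    Prop :=
  F =O[⊤] fun X => (1 + size X.1 X.2) ^ k

namespace HasGrowth

variable {E E' : Type*} [NormedAddCommGroup E] [NormedAddCommGroup E'] {k l : ℕ}

theorem exists_norm_le {F : Tensor d J × Scalar d J → E} (hF : HasGrowth k F) :
    ∃ c : ℝ, 0 ≤ c ∧ ∀ Q u, ‖F (Q, u)‖ ≤ c * (1 + size Q u) ^ k := by
  obtain ⟨c, hc, hF⟩ := hF.exists_nonneg
  refine ⟨c, hc, fun Q u => ?_⟩
  have hle := Asymptotics.isBigOWith_top.mp hF (Q, u)
  rwa [Real.norm_of_nonneg (pow_nonneg (by linarith [size_nonneg Q u]) k)] at hle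

theorem exists_norm_le_of_size_le {F : Tensor d J × Scalar d J → E} (hF : HasGrowth k F) (R : ℝ) :
    ∃ c : ℝ, ∀ Q u, size Q u ≤ R → ‖F (Q, u)‖ ≤ c := by
  obtain ⟨c, hc, hF⟩ := hF.exists_norm_le
  refine ⟨c * (1 + R) ^ k, fun Q u hR => (hF Q u).trans ?_⟩
  have := size_nonneg Q u
  gcongr

theorem mono {F : Tensor d J × Scalar d J → E} (hF : HasGrowth k F) (hkl : k ≤ l) :
    HasGrowth l F := by
  refine hF.trans (Asymptotics.isBigO_of_le _ fun X => ?_)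
  have h1 : 1 ≤ 1 + size X.1 X.2 := le_add_of_nonneg_right (size_nonneg _ _)
  have h0 : 0 ≤ 1 + size X.1 X.2 := zero_le_one.trans h1
  rw [Real.norm_of_nonneg (pow_nonneg h0 k), Real.norm_of_nonneg (pow_nonneg h0 l)]
  exact pow_le_pow_right₀ h1 hkl

theorem const (k : ℕ) (v : E) : HasGrowth k fun _ : Tensor d J × Scalar d J => v := by
  refine mono (k := 0) ?_ k.zero_le
  simpa only [HasGrowth, pow_zero] using Asymptotics.isBigO_const_const v one_ne_zero ⊤

theorem sum {ι : Type*} [Fintype ι] {F : ι → Tensor d J × Scalar d J → E}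
    (hF : ∀ i, HasGrowth k (F i)) : HasGrowth k fun X => ∑ i, F i X := by
  simpa only [HasGrowth, ← Finset.sum_fn] using
    Asymptotics.IsBigO.sum (s := Finset.univ) fun i _ => hF i

theorem mul {F G : Tensor d J × Scalar d J → ℝ} (hF : HasGrowth k F) (hG : HasGrowth l G) :
    HasGrowth (k + l) fun X => F X * G X := by
  simpa only [HasGrowth, pow_add] using Asymptotics.IsBigO.mul hF hG

theorem pow {F : Tensor d J × Scalar d J → ℝ} (hF : HasGrowth k F) (n : ℕ) :
    HasGrowth (k * n) fun X => F X ^ n := by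
  simpa only [HasGrowth, pow_mul] using Asymptotics.IsBigO.pow hF n

theorem map [NormedSpace ℝ E] [NormedSpace ℝ E'] [FiniteDimensional ℝ E]
    {F : Tensor d J × Scalar d J → E} (hF : HasGrowth k F) (T : E →ₗ[ℝ] E') :
    HasGrowth k fun X => T (F X) :=
  (T.toContinuousLinearMap.isBigO_comp F ⊤).trans hF

theorem pi {F : Tensor d J × Scalar d J → Scalar d J} (hF : ∀ x, HasGrowth k fun X => F X x) :
    HasGrowth k F :=
  Asymptotics.isBigO_pi.mpr hF

theorem apply {F : Tensor d J × Scalar d J → Scalar d J} (hF : HasGrowth k F) (x : Grid d J) :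
    HasGrowth k fun X => F X x :=
  Asymptotics.isBigO_pi.mp hF x

theorem l2 {F : Tensor d J × Scalar d J → Scalar d J} (hF : HasGrowth k F) :
    HasGrowth k fun X => l2 (F X) :=
  (hF.map (WithLp.linearEquiv 2 ℝ (Scalar d J)).symm.toLinearMap).norm_left

theorem size {Φ : Tensor d J × Scalar d J → Tensor d J} {F : Tensor d J × Scalar d J → Scalar d J}
    (hΦ : ∀ x i j, HasGrowth k fun X => Φ X x i j) (hF : ∀ x, HasGrowth k fun X => F X x) :
    HasGrowth k fun X => size (Φ X) (F X) :=
  (sum fun i => sum fun j => l2 (pi fun x => hΦ x i j)).add (pi hF).l2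

theorem entry (x : Grid d J) (i j : Fin d) :
    HasGrowth 1 fun X : Tensor d J × Scalar d J => X.1 x i j := by
  refine Asymptotics.isBigO_of_le _ fun X => ?_
  rw [pow_one]
  refine (abs_apply_le_l2 (Smectic.entry X.1 i j) x).trans ((l2_entry_le_size X.1 X.2 i j).trans ?_)
  exact (le_add_of_nonneg_left zero_le_one).trans (le_abs_self _)

theorem value (x : Grid d J) : HasGrowth 1 fun X : Tensor d J × Scalar d J => X.2 x := by
  refine Asymptotics.isBigO_of_le _ fun X => ?_
  rw [pow_one]
  refine (abs_apply_le_l2 X.2 x).trans ((l2_le_size X.1 X.2).trans ?_)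
  exact (le_add_of_nonneg_left zero_le_one).trans (le_abs_self _)

end HasGrowth

end

section

variable {d J : ℕ} [NeZero J]

namespace HasGrowth

theorem hessian (h : ℝ) (x : Grid d J) (i j : Fin d) :
    HasGrowth 1 fun X : Tensor d J × Scalar d J => hessian h X.2 x i j :=
  (((pi value).map (dCentral h j)).map (dCentral h i)).apply x

theorem divDiv {k : ℕ} (h : ℝ) {Φ : Tensor d J × Scalar d J → Tensor d J}
    (hΦ : ∀ x i j, HasGrowth k fun X => Φ X x i j) (x : Grid d J) :
    HasGrowth k fun X => divDiv h (Φ X) x := by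
  refine HasGrowth.apply (F := fun X => Smectic.divDiv h (Φ X)) ?_ x
  simp only [Smectic.divDiv]
  exact sum fun i => map (sum fun j => map (pi fun x => hΦ x i j) (dMinus h j)) (dMinus h i)

theorem sub_trace {k : ℕ} {Φ : Tensor d J × Scalar d J → Matrix (Fin d) (Fin d) ℝ}
    (hΦ : ∀ i j, HasGrowth k fun X => Φ X i j) (i j : Fin d) :
    HasGrowth k fun X =>
      (Φ X - ((Φ X).trace / (d : ℝ)) • (1 : Matrix (Fin d) (Fin d) ℝ)) i j := by
  have htr : HasGrowth k fun X => (Φ X).trace := sum fun l => hΦ l l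
  refine (hΦ i j).sub ?_
  simpa only [Matrix.smul_apply, smul_eq_mul, div_eq_inv_mul, mul_right_comm] using
    htr.const_mul_left ((d : ℝ)⁻¹ * (1 : Matrix (Fin d) (Fin d) ℝ) i j)

theorem sq_entry (x : Grid d J) (i j : Fin d) :
    HasGrowth 2 fun X : Tensor d J × Scalar d J => (X.1 x ^ 2) i j := by
  simp only [sq, Matrix.mul_apply]
  exact sum fun l => (entry x i l).mul (entry x l j)

theorem trace_sq (x : Grid d J) :
    HasGrowth 2 fun X : Tensor d J × Scalar d J => (X.1 x ^ 2).trace :=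
  sum fun i => sq_entry x i i

theorem trace_cube (x : Grid d J) :
    HasGrowth 3 fun X : Tensor d J × Scalar d J => (X.1 x ^ 3).trace := by
  simp only [pow_succ (_ : Matrix (Fin d) (Fin d) ℝ) 2, Matrix.trace, Matrix.diag_apply,
    Matrix.mul_apply]
  exact sum fun i => sum fun l => (sq_entry x i l).mul (entry x l i)

theorem orient (p : Params) (x : Grid d J) (i j : Fin d) :
    HasGrowth 1 fun X : Tensor d J × Scalar d J => p.orient X.1 x i j :=
  ((entry x i j).const_mul_left _).add (const 1 _)

theorem smul_orient (p : Params) (x : Grid d J) (i j : Fin d) :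
    HasGrowth 2 fun X : Tensor d J × Scalar d J => (X.2 x • p.orient X.1 x) i j :=
  (value x).mul (orient p x i j)

theorem forcing (p : Params) (h : ℝ) (x : Grid d J) (i j : Fin d) :
    HasGrowth 2 fun X : Tensor d J × Scalar d J => p.forcing h X.2 x i j :=
  (sub_trace (fun k l => (value x).mul (hessian h x k l)) i j).const_mul_left _

theorem aTilde (p : Params) (x : Grid d J) :
    HasGrowth 2 fun X : Tensor d J × Scalar d J => p.aTilde X.2 x :=
  (const 2 p.A).add (((value x).pow 2).const_mul_left _)

theorem varQ (p : Params) (h : ℝ) (x : Grid d J) (i j : Fin d) :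
    HasGrowth 3 fun X : Tensor d J × Scalar d J => p.varQ h X.1 X.2 x i j := by
  have hQ := entry x i j
  have hlow : HasGrowth 2 fun X : Tensor d J × Scalar d J => p.A * X.1 x i j - p.B *
      (X.1 x ^ 2 - ((X.1 x ^ 2).trace / (d : ℝ)) • (1 : Matrix (Fin d) (Fin d) ℝ)) i j :=
    (mono (hQ.const_mul_left p.A) one_le_two).sub
      ((sub_trace (sq_entry x) i j).const_mul_left p.B)
  exact ((mono hlow (Nat.le_succ 2)).add (mul ((trace_sq x).const_mul_left p.C) hQ)).add
    (mono (forcing p h x i j) (Nat.le_succ 2)) |>.add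
      (mul (((value x).pow 2).const_mul_left _) hQ)

theorem varU (p : Params) (h : ℝ) (x : Grid d J) :
    HasGrowth 3 fun X : Tensor d J × Scalar d J => p.varU h X.1 X.2 x := by
  have hu := value (d := d) (J := J) x
  have hpoly : HasGrowth 3 fun X : Tensor d J × Scalar d J =>
      p.a * X.2 x + p.b * X.2 x ^ 2 + p.c * X.2 x ^ 3 :=
    ((mono (hu.const_mul_left p.a) (by norm_num)).add
      (mono ((hu.pow 2).const_mul_left p.b) (by norm_num))).add ((hu.pow 3).const_mul_left p.c)
  have hhess : HasGrowth 2 fun X : Tensor d J × Scalar d J =>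
      ∑ i, ∑ j, p.orient X.1 x i j * Smectic.hessian h X.2 x i j :=
    sum fun i => sum fun j => (orient p x i j).mul (hessian h x i j)
  have hsq : HasGrowth 2 fun X : Tensor d J × Scalar d J => ∑ i, ∑ j, p.orient X.1 x i j ^ 2 :=
    sum fun i => sum fun j => (orient p x i j).pow 2
  exact ((hpoly.add (mono (hhess.const_mul_left _) (Nat.le_succ 2))).add
    (mono ((divDiv h (smul_orient p) x).const_mul_left _) (Nat.le_succ 2))).add
      (mul (hsq.const_mul_left _) hu)

theorem size_var (p : Params) (h : ℝ) :
    HasGrowth 3 fun X : Tensor d J × Scalar d J =>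
      Smectic.size (p.varQ h X.1 X.2) (p.varU h X.1 X.2) :=
  size (varQ p h) (varU p h)

theorem inner {k l : ℕ} (h : ℝ) {F G : Tensor d J × Scalar d J → Scalar d J}
    (hF : ∀ x, HasGrowth k fun X => F X x) (hG : ∀ x, HasGrowth l fun X => G X x) :
    HasGrowth (k + l) fun X => inner h (F X) (G X) :=
  Asymptotics.IsBigO.const_mul_left (sum fun x => (hF x).mul (hG x)) _

theorem innerT {k l : ℕ} (h : ℝ) {Φ Ψ : Tensor d J × Scalar d J → Tensor d J}
    (hΦ : ∀ x i j, HasGrowth k fun X => Φ X x i j)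
    (hΨ : ∀ x i j, HasGrowth l fun X => Ψ X x i j) :
    HasGrowth (k + l) fun X => innerT h (Φ X) (Ψ X) :=
  sum fun i => sum fun j => inner h (fun x => hΦ x i j) (fun x => hΨ x i j)

end HasGrowth

end

namespace Params

variable {d J : ℕ} [NeZero J]

/-- The part of `E_{1h}` of degree at most three; what remains is the penalty `B₀ q⁴ ‖M u‖²` and
the quartic bulk terms. -/
def lowerEnergy (p : Params) (h : ℝ) (Q : Tensor d J) (u : Scalar d J) : ℝ :=
  2 * p.B0 * p.q ^ 2 * innerT h (hessian h u) (fun x => u x • p.orient Q x)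
    + inner h (fun x => p.A / 2 * (Q x ^ 2).trace
        - (if d = 2 then 0 else p.B / 3) * (Q x ^ 3).trace
        + (p.a / 2 * u x ^ 2 + p.b / 3 * u x ^ 3)) 1

/-- The quartic bulk terms of `E_{1h}`. -/
def quarticEnergy (p : Params) (h : ℝ) (Q : Tensor d J) (u : Scalar d J) : ℝ :=
  inner h (fun x => p.C / 4 * (Q x ^ 2).trace ^ 2 + p.c / 4 * u x ^ 4) 1

theorem energy1_eq (p : Params) (h : ℝ) (Q : Tensor d J) (u : Scalar d J) :
    p.energy1 h Q u = p.lowerEnergy h Q u + p.B0 * p.q ^ 4 *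
      innerT h (fun x => u x • p.orient Q x) (fun x => u x • p.orient Q x)
        + p.quarticEnergy h Q u := by
  have hbulk : inner h (fun x => p.fbn (Q x)) 1 + inner h (fun x => p.fs (u x)) 1
      = inner h (fun x => p.A / 2 * (Q x ^ 2).trace
          - (if d = 2 then 0 else p.B / 3) * (Q x ^ 3).trace
          + (p.a / 2 * u x ^ 2 + p.b / 3 * u x ^ 3)) 1
        + inner h (fun x => p.C / 4 * (Q x ^ 2).trace ^ 2 + p.c / 4 * u x ^ 4) 1 := by
    simp only [inner, ← mul_add, ← Finset.sum_add_distrib, fbn, fs]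
    congr! 2 with x
    split_ifs <;> ring
  rw [energy1, add_assoc, hbulk, lowerEnergy, quarticEnergy]
  ring

theorem hasGrowth_lowerEnergy (p : Params) (h : ℝ) :
    HasGrowth 3 fun X : Tensor d J × Scalar d J => p.lowerEnergy h X.1 X.2 := by
  refine (Asymptotics.IsBigO.const_mul_left (HasGrowth.innerT h (HasGrowth.hessian h)
    (HasGrowth.smul_orient p)) _).add (HasGrowth.inner (l := 0) h (fun x => ?_)
      fun x => HasGrowth.const 0 _)
  have hu := HasGrowth.value (d := d) (J := J) x
  exact ((HasGrowth.mono ((HasGrowth.trace_sq x).const_mul_left _) (Nat.le_succ 2)).sub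
    ((HasGrowth.trace_cube x).const_mul_left _)).add
      ((HasGrowth.mono ((hu.pow 2).const_mul_left _) (Nat.le_succ 2)).add
        ((hu.pow 3).const_mul_left _))

theorem hasGrowth_energy1 (p : Params) (h : ℝ) :
    HasGrowth 4 fun X : Tensor d J × Scalar d J => p.energy1 h X.1 X.2 := by
  have hpenalty := (HasGrowth.innerT (d := d) (J := J) h (HasGrowth.smul_orient p)
    (HasGrowth.smul_orient p)).const_mul_left (p.B0 * p.q ^ 4)
  have hquartic : HasGrowth 4 fun X : Tensor d J × Scalar d J => p.quarticEnergy h X.1 X.2 :=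
    HasGrowth.inner (l := 0) h (fun x => (((HasGrowth.trace_sq x).pow 2).const_mul_left _).add
      (((HasGrowth.value x).pow 4).const_mul_left _)) fun x => HasGrowth.const 0 _
  simp only [energy1_eq]
  exact ((HasGrowth.mono (p.hasGrowth_lowerEnergy h) (by norm_num)).add hpenalty).add hquartic

theorem exists_le_quarticEnergy (p : Params) (hC : 0 < p.C) (hc : 0 < p.c) {h : ℝ} (hh : 0 < h) :
    ∃ κ : ℝ, 0 < κ ∧ ∀ (Q : Tensor d J) (u : Scalar d J), IsQTensor Q →
      κ * size Q u ^ 4 ≤ p.quarticEnergy h Q u := by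
  obtain ⟨c₀, hc₀, hsize⟩ := exists_size_pow_four_le d J
  have hm : 0 < min p.C p.c / 4 := div_pos (lt_min hC hc) four_pos
  refine ⟨h ^ d * (min p.C p.c / 4 * c₀), mul_pos (pow_pos hh d) (mul_pos hm hc₀), fun Q u hQ => ?_⟩
  have hpt (x : Grid d J) : min p.C p.c / 4 * (frob (Q x) ^ 4 + u x ^ 4)
      ≤ p.C / 4 * (Q x ^ 2).trace ^ 2 + p.c / 4 * u x ^ 4 := by
    rw [trace_sq_eq_frob_sq (hQ x).1, ← pow_mul, mul_add]
    gcongr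
    · exact min_le_left _ _
    · exact min_le_right _ _
  rw [quarticEnergy, inner, mul_assoc]
  gcongr
  simp only [Pi.one_apply, mul_one]
  calc min p.C p.c / 4 * c₀ * size Q u ^ 4
      ≤ min p.C p.c / 4 * ∑ x, (frob (Q x) ^ 4 + u x ^ 4) := by
        rw [mul_assoc]
        gcongr
        exact hsize Q u
    _ ≤ _ := by
        rw [Finset.mul_sum]
        exact Finset.sum_le_sum fun x _ => hpt x

theorem mul_cube_le_mul_pow_four_add {a b σ : ℝ} (ha : 0 < a) (hb : 0 ≤ b) (hσ : 0 ≤ σ) :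
    b * σ ^ 3 ≤ a * σ ^ 4 + b * (b / a) ^ 3 := by
  rcases le_total σ (b / a) with hle | hge
  · exact (mul_le_mul_of_nonneg_left (pow_le_pow_left₀ hσ hle 3) hb).trans
      (le_add_of_nonneg_left (by positivity))
  · calc b * σ ^ 3 ≤ a * σ * σ ^ 3 := by
          gcongr
          rwa [div_le_iff₀' ha] at hge
      _ = a * σ ^ 4 := by ring
      _ ≤ _ := le_add_of_nonneg_right (by positivity)

theorem exists_le_energy1 (p : Params) (hC : 0 < p.C) (hc : 0 < p.c) (hB0 : 0 ≤ p.B0) {h : ℝ}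
    (hh : 0 < h) : ∃ β : ℝ, ∀ (Q : Tensor d J) (u : Scalar d J), IsQTensor Q →
      (1 + size Q u) ^ 3 - β ≤ p.energy1 h Q u := by
  obtain ⟨κ, hκ, hquartic⟩ := p.exists_le_quarticEnergy (d := d) (J := J) hC hc hh
  obtain ⟨b, hb, hlower⟩ := (p.hasGrowth_lowerEnergy (d := d) (J := J) h).exists_norm_le
  refine ⟨κ + (b + 1) * ((b + 1) / (κ / 8)) ^ 3, fun Q u hQ => ?_⟩
  have hσ := size_nonneg Q u
  have hyoung := mul_cube_le_mul_pow_four_add (a := κ / 8) (b := b + 1) (by positivity)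
    (by positivity) (add_nonneg zero_le_one hσ)
  have hpow : κ / 8 * (1 + size Q u) ^ 4 ≤ κ * (1 + size Q u ^ 4) := by
    calc κ / 8 * (1 + size Q u) ^ 4 ≤ κ / 8 * (2 ^ (4 - 1) * (1 ^ 4 + size Q u ^ 4)) := by
          gcongr
          exact add_pow_le zero_le_one hσ 4
      _ = κ * (1 + size Q u ^ 4) := by ring
  have hpenalty : 0 ≤ p.B0 * p.q ^ 4 *
      innerT h (fun x => u x • p.orient Q x) (fun x => u x • p.orient Q x) := by
    refine mul_nonneg (by positivity) (Finset.sum_nonneg fun i _ => Finset.sum_nonneg fun j _ => ?_)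
    exact mul_nonneg (by positivity) (Finset.sum_nonneg fun x _ => mul_self_nonneg _)
  rw [energy1_eq]
  linarith [hquartic Q u hQ, neg_le_of_abs_le (hlower Q u)]

theorem exists_size_gFactor_smul_le (p : Params) (hC : 0 < p.C) (hc : 0 < p.c) (hB0 : 0 ≤ p.B0)
    {h : ℝ} (hh : 0 < h) : ∃ M : ℝ, 0 ≤ M ∧ ∀ (Q : Tensor d J) (u : Scalar d J) (s : ℝ),
      IsQTensor Q →
        size (p.gFactor h Q u s • p.varQ h Q u) (p.gFactor h Q u s • p.varU h Q u)
          ≤ M * Real.exp s := by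
  obtain ⟨β, hβ⟩ := p.exists_le_energy1 (d := d) (J := J) hC hc hB0 hh
  obtain ⟨c, hc, hvar⟩ := (HasGrowth.size_var (d := d) (J := J) p h).exists_norm_le
  refine ⟨c * Real.exp β, by positivity, fun Q u s hQ => ?_⟩
  have hexp : (1 + size Q u) ^ 3 ≤ Real.exp (β + p.energy1 h Q u) := by
    linarith [hβ Q u hQ, Real.add_one_le_exp (β + p.energy1 h Q u)]
  rw [size_smul, abs_of_pos (p.gFactor_pos h Q u s), p.gFactor_eq]
  calc Real.exp (s - p.energy1 h Q u) * size (p.varQ h Q u) (p.varU h Q u)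
      ≤ Real.exp (s - p.energy1 h Q u) * (c * Real.exp (β + p.energy1 h Q u)) := by
        gcongr
        exact (le_abs_self _).trans ((hvar Q u).trans (mul_le_mul_of_nonneg_left hexp hc))
    _ = c * Real.exp β * Real.exp s := by
        rw [mul_left_comm, ← Real.exp_add, mul_assoc, ← Real.exp_add]
        ring_nf

end Params

/-! ### Bounds uniform in the time step -/

theorem le_add_mul_exp_of_forall_succ_le {w : ℕ → ℝ} {b m τ T : ℝ} (hw₀ : 0 ≤ w 0) (hb : 0 ≤ b)
    (hm : 0 ≤ m) (hτ : 0 ≤ τ) (hw : ∀ n, w (n + 1) ≤ w n + τ * (m * (b + w n))) {n : ℕ}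
    (hn : n * τ ≤ T) : w n ≤ (w 0 + T * (m * b)) * Real.exp (T * m) := by
  have hgronwall := discrete_gronwall (n₀ := 0) (u := w) (b := fun _ => τ * (m * b))
    (c := fun _ => τ * m) hw₀ (fun n _ => (hw n).trans_eq (by ring)) (fun _ _ => by positivity)
    (fun _ _ => by positivity) n.zero_le
  simp only [Finset.sum_const, Nat.card_Ico, tsub_zero, nsmul_eq_mul, ← mul_assoc] at hgronwall
  have hT : 0 ≤ T := le_trans (by positivity) hn
  refine hgronwall.trans ?_
  rw [← mul_assoc]
  gcongr

theorem sub_le_of_forall_min_le {s : ℕ → ℝ} {a D τ T : ℝ} (hD : 0 ≤ D) (hτ : 0 ≤ τ)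
    (hs₀ : a ≤ s 0) (hs : ∀ n : ℕ, n * τ ≤ T → min (s n - τ * D) a ≤ s (n + 1)) {n : ℕ}
    (hn : n * τ ≤ T) : a - T * D ≤ s n := by
  suffices hdrift : a - n * τ * D ≤ s n by nlinarith
  induction n with
  | zero => simpa using hs₀
  | succ n ih =>
    have hn' : n * τ ≤ T := by
      refine le_trans ?_ hn
      gcongr
      exact n.le_succ
    refine le_trans (le_min ?_ ?_) (hs n hn')
    · have := ih hn'
      push_cast
      linarith
    · exact sub_le_self _ (by positivity)

theorem Op.IsPosSemidef.exists_l2_etdStep_sub_self_le {d J : ℕ} [NeZero J] {Λ : Op d J}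
    (hΛ : IsPosSemidef Λ) : ∃ l : ℝ, 0 ≤ l ∧ ∀ {γ τ : ℝ}, 0 < γ → 0 < τ → ∀ U F : Scalar d J,
      l2 (etdStep (Λ + γ • (1 : Op d J)) τ U (-F + γ • U) - U) ≤ τ * (l2 F + l * l2 U) := by
  obtain ⟨l, hl, hle⟩ := exists_l2_apply_le Λ
  refine ⟨l, hl, fun hγ hτ U F => (hΛ.l2_etdStep_sub_self_le hγ hτ U F).trans ?_⟩
  gcongr
  exact (l2_add_le _ _).trans (add_le_add_right (hle U) _)

namespace Params

variable {p : Params} {d J : ℕ} [NeZero J] {h η₀ τ κ₁ κ₂ : ℝ} {Q₀ : Tensor d J} {u₀ : Scalar d J}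

theorem IsNumericalSolution.s_succ_mem_uIcc {Q : ℕ → Tensor d J} {u : ℕ → Scalar d J} {s : ℕ → ℝ}
    (hsol : p.IsNumericalSolution h η₀ τ κ₁ κ₂ Q₀ u₀ Q u s) (n : ℕ) :
    s (n + 1) ∈ Set.uIcc (p.provisionalS h (Q n) (u n) (s n) (Q (n + 1)) (u (n + 1)))
      (p.energy1 h (Q (n + 1)) (u (n + 1))) := by
  obtain ⟨ξ, hξ, hs, -⟩ := hsol.step_s n
  rw [← segment_eq_uIcc]
  exact ⟨ξ, 1 - ξ, hξ.1, sub_nonneg.mpr hξ.2, add_sub_cancel ξ 1, hs.symm⟩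

theorem WeaklyAdmissible.exists_size_step_sub_le (hp : p.WeaklyAdmissible d) (hh : 0 < h) :
    ∃ m : ℝ, 0 ≤ m ∧ ∀ τ κ₁ κ₂ : ℝ, 0 < τ → 0 < κ₁ → 0 < κ₂ →
      ∀ (Q : Tensor d J) (u : Scalar d J) (s : ℝ), IsQTensor Q →
        size (p.stepQ h τ κ₁ Q u s - Q) (p.stepU h τ κ₂ Q u s - u)
          ≤ τ * (m * (Real.exp s + size Q u)) := by
  obtain ⟨l, hl, hlQ⟩ := (p.isPosSemidef_neg_smul_laplacian (d := d) (J := J) hp.K_nonneg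
    h).exists_l2_etdStep_sub_self_le
  obtain ⟨l', hl', hlU⟩ := (p.isPosSemidef_smul_laplacian_mul_self (d := d) (J := J) hp.B0_nonneg
    h).exists_l2_etdStep_sub_self_le
  obtain ⟨M, hM, hvar⟩ := p.exists_size_gFactor_smul_le (d := d) (J := J) hp.C_pos hp.c_pos
    hp.B0_nonneg hh
  refine ⟨((d : ℝ) ^ 2 + 1) * (M + (l + l')), by positivity,
    fun τ κ₁ κ₂ hτ hκ₁ hκ₂ Q u s hQ => ?_⟩
  have hg := p.gFactor_pos h Q u s
  have hF := hvar Q u s hQ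
  have hcomponent {F U : Scalar d J} {k : ℝ} (hk : k ≤ l + l') (hU : l2 U ≤ size Q u)
      (hF : l2 F ≤ M * Real.exp s) :
      τ * (l2 F + k * l2 U) ≤ τ * ((M + (l + l')) * (Real.exp s + size Q u)) := by
    have hkU : k * l2 U ≤ (l + l') * size Q u :=
      mul_le_mul hk hU (l2_nonneg U) (add_nonneg hl hl')
    gcongr
    nlinarith [mul_nonneg hM (size_nonneg Q u), mul_nonneg (add_nonneg hl hl') (Real.exp_nonneg s)]
  rw [mul_assoc, mul_left_comm]
  refine size_le_of_forall_le (fun i j => (hlQ (mul_pos hg hκ₁) hτ (entry Q i j) _).trans ?_)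
    ((hlU (mul_pos hg hκ₂) hτ u _).trans ?_)
  · exact hcomponent (le_add_of_nonneg_right hl') (l2_entry_le_size Q u i j)
      ((l2_entry_le_size _ _ i j).trans hF)
  · exact hcomponent (le_add_of_nonneg_left hl) (l2_le_size Q u) ((l2_le_size _ _).trans hF)

theorem WeaklyAdmissible.exists_abs_provisionalS_sub_le (hp : p.WeaklyAdmissible d) (hh : 0 < h) :
    ∃ m : ℝ, 0 ≤ m ∧ ∀ (Q : Tensor d J) (u : Scalar d J) (s : ℝ) (Q' : Tensor d J)
      (u' : Scalar d J), IsQTensor Q →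
        |p.provisionalS h Q u s Q' u' - s| ≤ m * Real.exp s * size (Q' - Q) (u' - u) := by
  obtain ⟨M, hM, hvar⟩ := p.exists_size_gFactor_smul_le (d := d) (J := J) hp.C_pos hp.c_pos
    hp.B0_nonneg hh
  refine ⟨h ^ d * M, by positivity, fun Q u s Q' u' hQ => ?_⟩
  rw [provisionalS_eq, add_sub_cancel_left, mul_assoc (h ^ d), mul_assoc (h ^ d)]
  refine (abs_innerT_add_inner_le hh.le _ _ _ _).trans ?_
  gcongr
  · exact size_nonneg _ _
  · exact hvar Q u s hQ

theorem WeaklyAdmissible.exists_size_le_of_le (hp : p.WeaklyAdmissible d) (hh : 0 < h)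
    (hQ₀ : IsQTensor Q₀) (u₀ : Scalar d J) (T E : ℝ) :
    ∃ R : ℝ, ∀ η₀ τ κ₁ κ₂ : ℝ, 0 < τ → 0 < κ₁ → 0 < κ₂ →
      ∀ (Q : ℕ → Tensor d J) (u : ℕ → Scalar d J) (s : ℕ → ℝ),
        p.IsNumericalSolution h η₀ τ κ₁ κ₂ Q₀ u₀ Q u s → (∀ n, s n ≤ E) →
        ∀ n : ℕ, n * τ ≤ T → size (Q n) (u n) ≤ R := by
  obtain ⟨m, hm, hstep⟩ := hp.exists_size_step_sub_le (J := J) hh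
  refine ⟨(size Q₀ u₀ + T * (m * Real.exp E)) * Real.exp (T * m),
    fun η₀ τ κ₁ κ₂ hτ hκ₁ hκ₂ Q u s hsol hsE n hn => ?_⟩
  have hsucc (n : ℕ) : size (Q (n + 1)) (u (n + 1))
      ≤ size (Q n) (u n) + τ * (m * (Real.exp E + size (Q n) (u n))) := by
    refine (size_le_add_size_sub (Q n) _ (u n) _).trans (add_le_add_right ?_ _)
    rw [hsol.step_Q, hsol.step_u]
    refine (hstep τ κ₁ κ₂ hτ hκ₁ hκ₂ _ _ _ (hsol.isQTensor hp.dim_ne_zero hQ₀ n)).trans ?_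
    gcongr
    exact hsE n
  have hgronwall := le_add_mul_exp_of_forall_succ_le (w := fun n => size (Q n) (u n))
    (size_nonneg _ _) (Real.exp_nonneg E) hm hτ.le hsucc hn
  rwa [hsol.init_Q, hsol.init_u] at hgronwall

theorem WeaklyAdmissible.exists_le_s_of_le (hp : p.WeaklyAdmissible d) (hh : 0 < h)
    (hQ₀ : IsQTensor Q₀) (u₀ : Scalar d J) (T E R : ℝ) :
    ∃ r : ℝ, ∀ η₀ τ κ₁ κ₂ : ℝ, 0 < τ → 0 < κ₁ → 0 < κ₂ →
      ∀ (Q : ℕ → Tensor d J) (u : ℕ → Scalar d J) (s : ℕ → ℝ),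
        p.IsNumericalSolution h η₀ τ κ₁ κ₂ Q₀ u₀ Q u s → (∀ n, s n ≤ E) →
        (∀ n : ℕ, n * τ ≤ T → size (Q n) (u n) ≤ R) → ∀ n : ℕ, n * τ ≤ T → r ≤ s n := by
  obtain ⟨m, hm, hstep⟩ := hp.exists_size_step_sub_le (J := J) hh
  obtain ⟨m', hm', hprov⟩ := hp.exists_abs_provisionalS_sub_le (J := J) hh
  obtain ⟨β, hβ⟩ := p.exists_le_energy1 (d := d) (J := J) hp.C_pos hp.c_pos hp.B0_nonneg hh
  set D := m' * Real.exp E * (m * (Real.exp E + |R|))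
  refine ⟨-β - T * D, fun η₀ τ κ₁ κ₂ hτ hκ₁ hκ₂ Q u s hsol hsE hsize n hn => ?_⟩
  have hQ := hsol.isQTensor hp.dim_ne_zero hQ₀
  have henergy (n : ℕ) : -β ≤ p.energy1 h (Q n) (u n) := by
    have := pow_nonneg (add_nonneg zero_le_one (size_nonneg (Q n) (u n))) 3
    linarith [hβ _ (u n) (hQ n)]
  refine sub_le_of_forall_min_le (by positivity) hτ.le ?_ (fun n hn => ?_) hn
  · rw [hsol.init_s, ← hsol.init_Q, ← hsol.init_u]
    exact henergy 0
  · refine le_trans (min_le_min ?_ (henergy (n + 1))) (hsol.s_succ_mem_uIcc n).1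
    have hδ := hstep τ κ₁ κ₂ hτ hκ₁ hκ₂ _ (u n) (s n) (hQ n)
    rw [← hsol.step_Q, ← hsol.step_u] at hδ
    have hdrift : m' * Real.exp (s n) * size (Q (n + 1) - Q n) (u (n + 1) - u n) ≤ τ * D :=
      calc m' * Real.exp (s n) * size (Q (n + 1) - Q n) (u (n + 1) - u n)
          ≤ m' * Real.exp E * (τ * (m * (Real.exp E + |R|))) := by
            refine mul_le_mul ?_ (hδ.trans ?_) (size_nonneg _ _) (by positivity)
            · gcongr
              exact hsE n
            · gcongr
              · exact hsE n
              · exact (hsize n hn).trans (le_abs_self R)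
        _ = τ * D := mul_left_comm _ _ _
    linarith [neg_le_of_abs_le (hprov _ (u n) (s n) (Q (n + 1)) (u (n + 1)) (hQ n))]

theorem WeaklyAdmissible.exists_bound_of_mul_le_one (hp : p.WeaklyAdmissible d) (hh : 0 < h)
    (η₀ : ℝ) (hQ₀ : IsQTensor Q₀) (u₀ : Scalar d J) (T : ℝ) :
    ∃ R : ℝ, ∀ τ κ₁ κ₂ : ℝ, 0 < τ → 0 < κ₁ → 0 < κ₂ → η₀ * τ ≤ 1 →
      ∀ (Q : ℕ → Tensor d J) (u : ℕ → Scalar d J) (s : ℕ → ℝ),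
        p.IsNumericalSolution h η₀ τ κ₁ κ₂ Q₀ u₀ Q u s → ∀ n : ℕ, n * τ ≤ T →
          size (Q n) (u n) ≤ R ∧ |s n| ≤ R := by
  set E := p.modEnergy h Q₀ u₀ (p.energy1 h Q₀ u₀)
  obtain ⟨R, hR⟩ := hp.exists_size_le_of_le hh hQ₀ u₀ T E
  obtain ⟨r, hr⟩ := hp.exists_le_s_of_le hh hQ₀ u₀ T E R
  refine ⟨max R (max |E| |r|), fun τ κ₁ κ₂ hτ hκ₁ hκ₂ hητ Q u s hsol n hn => ?_⟩
  have hsE := hsol.le_modEnergy hp.K_nonneg hp.B0_nonneg hh.le hτ hκ₁ hκ₂ hητ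
  have hsize := hR η₀ τ κ₁ κ₂ hτ hκ₁ hκ₂ Q u s hsol hsE
  have hrs := hr η₀ τ κ₁ κ₂ hτ hκ₁ hκ₂ Q u s hsol hsE hsize n hn
  refine ⟨(hsize n hn).trans (le_max_left _ _), le_trans ?_ (le_max_right _ _)⟩
  rw [max_comm]
  exact abs_le_max_abs_abs hrs (hsE n)

theorem WeaklyAdmissible.exists_bound_succ (hp : p.WeaklyAdmissible d) (hh : 0 < h)
    (hQ₀ : IsQTensor Q₀) (u₀ : Scalar d J) (T R : ℝ) :
    ∃ R' : ℝ, ∀ η₀ τ κ₁ κ₂ : ℝ, 0 < τ → τ ≤ T → 0 < κ₁ → 0 < κ₂ →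
      ∀ (Q : ℕ → Tensor d J) (u : ℕ → Scalar d J) (s : ℕ → ℝ),
        p.IsNumericalSolution h η₀ τ κ₁ κ₂ Q₀ u₀ Q u s → ∀ n : ℕ,
          size (Q n) (u n) ≤ R → |s n| ≤ R →
          size (Q (n + 1)) (u (n + 1)) ≤ R' ∧ |s (n + 1)| ≤ R' := by
  obtain ⟨m, hm, hstep⟩ := hp.exists_size_step_sub_le (J := J) hh
  obtain ⟨m', hm', hprov⟩ := hp.exists_abs_provisionalS_sub_le (J := J) hh
  let r := T * (m * (Real.exp R + R))
  obtain ⟨e, he⟩ := (p.hasGrowth_energy1 (d := d) (J := J) h).exists_norm_le_of_size_le (R + r)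
  refine ⟨max (R + r) (max (R + m' * Real.exp R * r) e),
    fun η₀ τ κ₁ κ₂ hτ hτT hκ₁ hκ₂ Q u s hsol n hsize hs => ?_⟩
  have hQ := hsol.isQTensor hp.dim_ne_zero hQ₀ n
  have hexp : Real.exp (s n) ≤ Real.exp R := Real.exp_le_exp.mpr (le_of_abs_le hs)
  have hδ : size (Q (n + 1) - Q n) (u (n + 1) - u n) ≤ r :=
    calc size (Q (n + 1) - Q n) (u (n + 1) - u n)
        ≤ τ * (m * (Real.exp (s n) + size (Q n) (u n))) := by
          rw [hsol.step_Q, hsol.step_u]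
          exact hstep τ κ₁ κ₂ hτ hκ₁ hκ₂ _ _ _ hQ
      _ ≤ T * (m * (Real.exp R + R)) := by
          have := size_nonneg (Q n) (u n)
          have : 0 ≤ T := hτ.le.trans hτT
          gcongr
  have hsize' : size (Q (n + 1)) (u (n + 1)) ≤ R + r :=
    (size_le_add_size_sub (Q n) _ (u n) _).trans (add_le_add hsize hδ)
  have hprov' : |p.provisionalS h (Q n) (u n) (s n) (Q (n + 1)) (u (n + 1))|
      ≤ R + m' * Real.exp R * r := by
    have hle := (hprov _ (u n) (s n) (Q (n + 1)) (u (n + 1)) hQ).trans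
      (mul_le_mul (mul_le_mul_of_nonneg_left hexp hm') hδ (size_nonneg _ _) (by positivity))
    linarith [abs_sub_abs_le_abs_sub (p.provisionalS h (Q n) (u n) (s n) (Q (n + 1)) (u (n + 1)))
      (s n)]
  refine ⟨hsize'.trans (le_max_left _ _), le_max_of_le_right (abs_le.mpr ?_)⟩
  exact Set.uIcc_subset_Icc (abs_le.mp (hprov'.trans (le_max_left _ _)))
    (abs_le.mp ((he _ _ hsize').trans (le_max_right _ _))) (hsol.s_succ_mem_uIcc n)

theorem WeaklyAdmissible.exists_bound_at_level (hp : p.WeaklyAdmissible d) (hh : 0 < h)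
    (η₀ : ℝ) (hQ₀ : IsQTensor Q₀) (u₀ : Scalar d J) (T : ℝ) (n : ℕ) :
    ∃ R : ℝ, ∀ τ κ₁ κ₂ : ℝ, 0 < τ → 0 < κ₁ → 0 < κ₂ →
      ∀ (Q : ℕ → Tensor d J) (u : ℕ → Scalar d J) (s : ℕ → ℝ),
        p.IsNumericalSolution h η₀ τ κ₁ κ₂ Q₀ u₀ Q u s → n * τ ≤ T →
          size (Q n) (u n) ≤ R ∧ |s n| ≤ R := by
  induction n with
  | zero =>
    refine ⟨max (size Q₀ u₀) |p.energy1 h Q₀ u₀|, fun τ κ₁ κ₂ _ _ _ Q u s hsol _ => ?_⟩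
    rw [hsol.init_Q, hsol.init_u, hsol.init_s]
    exact ⟨le_max_left _ _, le_max_right _ _⟩
  | succ n ih =>
    obtain ⟨R, hR⟩ := ih
    obtain ⟨R', hR'⟩ := hp.exists_bound_succ hh hQ₀ u₀ T R
    refine ⟨R', fun τ κ₁ κ₂ hτ hκ₁ hκ₂ Q u s hsol hn => ?_⟩
    rw [Nat.cast_succ, add_one_mul] at hn
    have hnτ : 0 ≤ n * τ := by positivity
    obtain ⟨hsize, hs⟩ := hR τ κ₁ κ₂ hτ hκ₁ hκ₂ Q u s hsol (by linarith)
    exact hR' η₀ τ κ₁ κ₂ hτ (by linarith) hκ₁ hκ₂ Q u s hsol n hsize hs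

theorem WeaklyAdmissible.exists_bound (hp : p.WeaklyAdmissible d) (hh : 0 < h) (η₀ : ℝ)
    (hQ₀ : IsQTensor Q₀) (u₀ : Scalar d J) (T : ℝ) :
    ∃ R : ℝ, ∀ τ κ₁ κ₂ : ℝ, 0 < τ → 0 < κ₁ → 0 < κ₂ →
      ∀ (Q : ℕ → Tensor d J) (u : ℕ → Scalar d J) (s : ℕ → ℝ),
        p.IsNumericalSolution h η₀ τ κ₁ κ₂ Q₀ u₀ Q u s → ∀ n : ℕ, n * τ ≤ T →
          size (Q n) (u n) ≤ R ∧ |s n| ≤ R := by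
  obtain ⟨R, hR⟩ := hp.exists_bound_of_mul_le_one hh η₀ hQ₀ u₀ T
  choose R' hR' using hp.exists_bound_at_level hh η₀ hQ₀ u₀ T
  obtain ⟨m, hm⟩ := ((Set.finite_Iic ⌊η₀ * T⌋₊).image R').bddAbove
  refine ⟨max R m, fun τ κ₁ κ₂ hτ hκ₁ hκ₂ Q u s hsol n hn => ?_⟩
  rcases le_or_gt (η₀ * τ) 1 with hητ | hητ
  · exact (hR τ κ₁ κ₂ hτ hκ₁ hκ₂ hητ Q u s hsol n hn).imp (le_max_of_le_left ·)
      (le_max_of_le_left ·)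
  · have hη₀ : 0 < η₀ := pos_of_mul_pos_left (zero_lt_one.trans hητ) hτ.le
    have hlevel : n ≤ ⌊η₀ * T⌋₊ := Nat.le_floor <| calc
      (n : ℝ) ≤ n * (η₀ * τ) := le_mul_of_one_le_right n.cast_nonneg hητ.le
      _ = η₀ * (n * τ) := mul_left_comm _ _ _
      _ ≤ η₀ * T := by gcongr
    have hle : R' n ≤ max R m := (hm (Set.mem_image_of_mem R' hlevel)).trans (le_max_right _ _)
    exact (hR' n τ κ₁ κ₂ hτ hκ₁ hκ₂ Q u s hsol hn).imp (·.trans hle) (·.trans hle)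

theorem exists_levelBounds (p : Params) (h R : ℝ) :
    ∃ G S Amax : ℝ, 0 < G ∧ ∀ (Q : Tensor d J) (u : Scalar d J) (s : ℝ),
      size Q u ≤ R → |s| ≤ R → p.LevelBounds h G S Amax Q u s := by
  have hfrob : HasGrowth 4 fun X : Tensor d J × Scalar d J =>
      (fun x => ∑ i, ∑ j, p.forcing h X.2 x i j ^ 2 : Scalar d J) :=
    .pi fun x => .sum fun i => .sum fun j => (HasGrowth.forcing p h x i j).pow 2
  have hA : HasGrowth 2 fun X : Tensor d J × Scalar d J => (p.aTilde X.2 : Scalar d J) :=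
    .pi fun x => .aTilde p x
  obtain ⟨S, hS⟩ := hfrob.exists_norm_le_of_size_le R
  obtain ⟨Amax, hAmax⟩ := hA.exists_norm_le_of_size_le R
  obtain ⟨e, he⟩ := (p.hasGrowth_energy1 (d := d) (J := J) h).exists_norm_le_of_size_le R
  refine ⟨Real.exp (-R - e), √S, Amax, Real.exp_pos _, fun Q u s hsize hs => ⟨?_, ?_, fun x => ?_⟩⟩
  · rw [gFactor_eq]
    exact Real.exp_le_exp.mpr (sub_le_sub (neg_le_of_abs_le hs) (le_of_abs_le (he Q u hsize)))
  · rw [supNorm_le_iff]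
    exact fun x => Real.sqrt_le_sqrt
      ((le_abs_self _).trans ((norm_le_pi_norm _ x).trans (hS Q u hsize)))
  · exact (le_abs_self _).trans ((norm_le_pi_norm _ x).trans (hAmax Q u hsize))

theorem WeaklyAdmissible.exists_uniform_levelBounds (hp : p.WeaklyAdmissible d) (hh : 0 < h)
    (η₀ : ℝ) (hQ₀ : IsQTensor Q₀) (u₀ : Scalar d J) (T : ℝ) :
    ∃ G S Amax : ℝ, 0 < G ∧ ∀ τ κ₁ κ₂ : ℝ, 0 < τ → 0 < κ₁ → 0 < κ₂ →
      ∀ (Q : ℕ → Tensor d J) (u : ℕ → Scalar d J) (s : ℕ → ℝ),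
        p.IsNumericalSolution h η₀ τ κ₁ κ₂ Q₀ u₀ Q u s → ∀ n : ℕ, n * τ ≤ T →
          p.LevelBounds h G S Amax (Q n) (u n) (s n) := by
  obtain ⟨R, hR⟩ := hp.exists_bound hh η₀ hQ₀ u₀ T
  obtain ⟨G, S, Amax, hG, hbounds⟩ := p.exists_levelBounds (d := d) (J := J) h R
  refine ⟨G, S, Amax, hG, fun τ κ₁ κ₂ hτ hκ₁ hκ₂ Q u s hsol n hn => ?_⟩
  obtain ⟨hsize, hs⟩ := hR τ κ₁ κ₂ hτ hκ₁ hκ₂ Q u s hsol n hn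
  exact hbounds _ _ _ hsize hs

end Params

end

end Smectic

theorem theorem4p5_general {d J : ℕ} [NeZero J] (p : Smectic.Params) (hp : p.WeaklyAdmissible d)
    (h : ℝ) (hh : 0 < h) (η₀ : ℝ) (Q₀ : Smectic.Tensor d J) (hQ₀ : Smectic.IsQTensor Q₀)
    (u₀ : Smectic.Scalar d J) :
    (∀ T : ℝ, ∃ G S Amax : ℝ, 0 < G ∧
      ∀ τ κ₁ κ₂ : ℝ, 0 < τ → 0 < κ₁ → 0 < κ₂ →
      ∀ (Q : ℕ → Smectic.Tensor d J) (u : ℕ → Smectic.Scalar d J) (s : ℕ → ℝ),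
        p.IsNumericalSolution h η₀ τ κ₁ κ₂ Q₀ u₀ Q u s →
        ∀ n : ℕ, n * τ ≤ T → p.LevelBounds h G S Amax (Q n) (u n) (s n)) ∧
    (∀ S : ℝ, ∃ ηmin : ℝ, 0 < ηmin ∧ ∀ η : ℝ, ηmin ≤ η → p.fPoly d S η ≤ 0) ∧
    (∀ τ κ₁ κ₂ : ℝ, 0 < τ → 0 < κ₁ →
      ∀ (Q : ℕ → Smectic.Tensor d J) (u : ℕ → Smectic.Scalar d J) (s : ℕ → ℝ),
        p.IsNumericalSolution h η₀ τ κ₁ κ₂ Q₀ u₀ Q u s →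
      ∀ (N : ℕ∞) (G S Amax η : ℝ), 0 < G →
        (∀ n : ℕ, (n : ℕ∞) < N → p.LevelBounds h G S Amax (Q n) (u n) (s n)) →
        p.fPoly d S η ≤ 0 → Smectic.supNorm Q₀ ≤ η → p.kappa0 d Amax η / G ≤ κ₁ →
        ∀ n : ℕ, (n : ℕ∞) ≤ N → Smectic.supNorm (Q n) ≤ η) := by
  refine ⟨hp.exists_uniform_levelBounds hh η₀ hQ₀ u₀, p.exists_fPoly_nonpos d hp.C_pos, ?_⟩
  intro τ κ₁ κ₂ hτ hκ₁ Q u s hsol N G S Amax η hG hb hf hQη hκ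
  exact hsol.supNorm_le hp hQ₀ hτ hκ₁ hG hb hf hQη hκ

theorem theorem4p5 {d J : ℕ} [NeZero J] (p : Smectic.Params) (hp : p.Admissible d)
    (Ld : ℝ) (hLd : 0 < Ld) (η₀ : ℝ) (hη₀ : η₀ ∈ Set.Icc (0 : ℝ) 1)
    (Q₀ : Smectic.Tensor d J) (hQ₀ : Smectic.IsQTensor Q₀) (u₀ : Smectic.Scalar d J) :
    -- constants `G`, `S`, `Amax` independent of `τ`, `κ₁`, `κ₂` and `n` exist on every `[0, T]`
    (∀ T : ℝ, 0 < T → ∃ G S Amax : ℝ, 0 < G ∧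
      ∀ τ κ₁ κ₂ : ℝ, 0 < τ → 0 < κ₁ → 0 < κ₂ →
      ∀ (Q : ℕ → Smectic.Tensor d J) (u : ℕ → Smectic.Scalar d J) (s : ℕ → ℝ),
        p.IsNumericalSolution (Ld / J) η₀ τ κ₁ κ₂ Q₀ u₀ Q u s →
        ∀ n : ℕ, n * τ ≤ T → p.LevelBounds (Ld / J) G S Amax (Q n) (u n) (s n)) ∧
    -- every sufficiently large `η` satisfies `f_d(η) ≤ 0`
    (∀ S : ℝ, ∃ ηmin : ℝ, 0 < ηmin ∧ ∀ η : ℝ, ηmin ≤ η → p.fPoly d S η ≤ 0) ∧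
    -- maximum bound principle, for every time step `τ`, on every finite or infinite range of `n`
    (∀ τ κ₁ κ₂ : ℝ, 0 < τ → 0 < κ₁ → 0 < κ₂ →
      ∀ (Q : ℕ → Smectic.Tensor d J) (u : ℕ → Smectic.Scalar d J) (s : ℕ → ℝ),
        p.IsNumericalSolution (Ld / J) η₀ τ κ₁ κ₂ Q₀ u₀ Q u s →
      ∀ (N : ℕ∞) (G S Amax η : ℝ), 0 < G →
        (∀ n : ℕ, (n : ℕ∞) < N → p.LevelBounds (Ld / J) G S Amax (Q n) (u n) (s n)) →
        0 < η → p.fPoly d S η ≤ 0 → Smectic.supNorm Q₀ ≤ η →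
        p.kappa0 d Amax η / G ≤ κ₁ →
        ∀ n : ℕ, (n : ℕ∞) ≤ N → Smectic.supNorm (Q n) ≤ η) := by
  obtain ⟨hbounds, hf, hmax⟩ := theorem4p5_general p hp.weaklyAdmissible (Ld / J)
    (div_pos hLd (Nat.cast_pos.mpr (NeZero.pos J))) η₀ Q₀ hQ₀ u₀
  exact ⟨fun T _ => hbounds T, hf, fun τ κ₁ κ₂ hτ hκ₁ _ Q u s hsol N G S Amax η hG hb _ =>
    hmax τ κ₁ κ₂ hτ hκ₁ Q u s hsol N G S Amax η hG hb⟩
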